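/- Let $G$ be a real Lie group of dimension $4$ (not necessarily connected) with Lie algebra $\mathfrak g$, equipped with a bi-invariant semi-Riemannian metric $k$ (a smooth field of nondegenerate symmetric bilinear forms on the tangent spaces, of arbitrary signature, preserved by all left and right translations); such a pair $(G,k)$ is called a quadratic Lie group. Suppose that $(G,k)$ is undecomposable, i.e. the restriction of $k$ to every ideal of $\mathfrak g$ other than $0$ and $\mathfrak g$ is degenerate. Then: (a) $G$ admits a left invariant affine structure, i.e. a smooth left invariant affine connection on $G$ that is torsion-free and has vanishing curvature; (b) $G$ admits no flat left invariant semi-Riemannian metric: there is no left invariant semi-Riemannian metric on $G$, of any signature, whose Levi-Civita connection has vanishing curvature. -/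

import Mathlib

open scoped Manifold ContDiff

noncomputable section

namespace QuadraticLie

section Manifolds

variable {E : Type*} [NormedAddCommGroup E] [NormedSpace ℝ E]
  {H : Type*} [TopologicalSpace H] (I : ModelWithCorners ℝ E H)
  (M : Type*) [TopologicalSpace M] [ChartedSpace H M]

/-- A vector field `X` on the manifold `M` is smooth. -/
def IsSmoothField {I : ModelWithCorners ℝ E H} {M : Type*} [TopologicalSpace M]
    [ChartedSpace H M] [IsManifold I 1 M] (X : Π x : M, TangentSpace I x) : Prop :=
  ContMDiff I (I.prod 𝓘(ℝ, E)) ∞ (fun x ↦ Bundle.TotalSpace.mk' E x (X x))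

/-- A semi-Riemannian metric: a smooth field of nondegenerate symmetric bilinear forms on the
tangent spaces, of arbitrary signature. -/
structure SemiRiemannianMetric [IsManifold I 1 M] where
  /-- The scalar product on each tangent space. -/
  form : Π x : M, TangentSpace I x →L[ℝ] TangentSpace I x →L[ℝ] ℝ
  symm : ∀ (x : M) (v w : TangentSpace I x), form x v w = form x w v
  nondegenerate : ∀ (x : M) (v : TangentSpace I x), (∀ w, form x v w = 0) → v = 0
  contMDiff : ContMDiff I (I.prod 𝓘(ℝ, E →L[ℝ] E →L[ℝ] ℝ)) ∞
    (fun x ↦ Bundle.TotalSpace.mk' (E →L[ℝ] E →L[ℝ] ℝ)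
      (E := fun x ↦ TangentSpace I x →L[ℝ] TangentSpace I x →L[ℝ] ℝ) x (form x))

variable {I M} [IsManifold I 1 M]

/-- The affine connection `∇` is smooth. (Here `cov Y x (X x)` is `∇_X Y` at `x`.) -/
def IsSmoothConnection (cov : CovariantDerivative I E (fun x : M ↦ TangentSpace I x)) : Prop :=
  CovariantDerivative.ContMDiffCovariantDerivative cov ∞

/-- `∇_X Y - ∇_Y X = [X, Y]` for all smooth vector fields `X`, `Y`. -/
def IsTorsionFree (cov : CovariantDerivative I E (fun x : M ↦ TangentSpace I x)) : Prop :=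
  ∀ X Y : Π x : M, TangentSpace I x, IsSmoothField X → IsSmoothField Y →
    ∀ x, cov Y x (X x) - cov X x (Y x) = VectorField.mlieBracket I X Y x

/-- The curvature `R(X, Y) Z = ∇_X ∇_Y Z - ∇_Y ∇_X Z - ∇_[X, Y] Z`. -/
def curvature (cov : CovariantDerivative I E (fun x : M ↦ TangentSpace I x))
    (X Y Z : Π x : M, TangentSpace I x) (x : M) : TangentSpace I x :=
  cov (fun y ↦ cov Z y (Y y)) x (X x) - cov (fun y ↦ cov Z y (X y)) x (Y x)
    - cov Z x (VectorField.mlieBracket I X Y x)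

/-- The curvature of the connection vanishes on all smooth vector fields. -/
def IsFlatConnection (cov : CovariantDerivative I E (fun x : M ↦ TangentSpace I x)) : Prop :=
  ∀ X Y Z : Π x : M, TangentSpace I x, IsSmoothField X → IsSmoothField Y → IsSmoothField Z →
    ∀ x, curvature cov X Y Z x = 0

/-- `v ⟨Y, Z⟩ = ⟨∇_v Y, Z⟩ + ⟨Y, ∇_v Z⟩` for smooth vector fields `Y`, `Z` and tangent
vectors `v`. -/
def IsMetricConnection (g : SemiRiemannianMetric I M)
    (cov : CovariantDerivative I E (fun x : M ↦ TangentSpace I x)) : Prop :=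
  ∀ Y Z : Π x : M, TangentSpace I x, IsSmoothField Y → IsSmoothField Z →
    ∀ (x : M) (v : TangentSpace I x),
      (mfderiv I 𝓘(ℝ, ℝ) (fun y ↦ g.form y (Y y) (Z y)) x v : ℝ)
        = g.form x (cov Y x v) (Z x) + g.form x (Y x) (cov Z x v)

/-- `cov` is the Levi-Civita connection of `g`. -/
structure IsLeviCivita (g : SemiRiemannianMetric I M)
    (cov : CovariantDerivative I E (fun x : M ↦ TangentSpace I x)) : Prop where
  smooth : IsSmoothConnection cov
  torsionFree : IsTorsionFree cov
  metric : IsMetricConnection g cov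

/-- A semi-Riemannian metric is flat when the curvature of its Levi-Civita connection vanishes. -/
def SemiRiemannianMetric.IsFlat (g : SemiRiemannianMetric I M) : Prop :=
  ∃ cov : CovariantDerivative I E (fun x : M ↦ TangentSpace I x),
    IsLeviCivita g cov ∧ IsFlatConnection cov

end Manifolds

section Groups

variable {E : Type*} [NormedAddCommGroup E] [NormedSpace ℝ E]
  {H : Type*} [TopologicalSpace H] {I : ModelWithCorners ℝ E H}
  {G : Type*} [TopologicalSpace G] [ChartedSpace H G] [Group G]

section Invariance

variable [IsManifold I 1 G]

/-- All left translations are isometries. -/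
def SemiRiemannianMetric.IsLeftInvariant (g : SemiRiemannianMetric I G) : Prop :=
  ∀ (a x : G) (v w : TangentSpace I x),
    g.form (a * x) (mfderiv I I (fun y ↦ a * y) x v) (mfderiv I I (fun y ↦ a * y) x w)
      = g.form x v w

/-- All right translations are isometries. -/
def SemiRiemannianMetric.IsRightInvariant (g : SemiRiemannianMetric I G) : Prop :=
  ∀ (a x : G) (v w : TangentSpace I x),
    g.form (x * a) (mfderiv I I (fun y ↦ y * a) x v) (mfderiv I I (fun y ↦ y * a) x w)
      = g.form x v w

/-- Left and right translations are isometries; a Lie group with such a metric is a quadratic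
(or orthogonal) Lie group. -/
def SemiRiemannianMetric.IsBiInvariant (g : SemiRiemannianMetric I G) : Prop :=
  g.IsLeftInvariant ∧ g.IsRightInvariant

/-- All left translations are affine maps of the connection: with `L` the translation by `a`,
`L_* (∇_v (L^* Y)) = ∇_{L_* v} Y` for every smooth vector field `Y` and tangent vector `v`. -/
def IsLeftInvariantConnection
    (cov : CovariantDerivative I E (fun x : G ↦ TangentSpace I x)) : Prop :=
  ∀ (a : G) (Y : Π x : G, TangentSpace I x), IsSmoothField Y →
    ∀ (x : G) (v : TangentSpace I x),
      mfderiv I I (fun y ↦ a * y) x (cov (VectorField.mpullback I I (fun y ↦ a * y) Y) x v)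
        = cov Y (a * x) (mfderiv I I (fun y ↦ a * y) x v)

/-- A left invariant affine structure: a smooth left invariant affine connection that is flat and
torsion-free. -/
structure IsLeftInvariantAffineStructure
    (cov : CovariantDerivative I E (fun x : G ↦ TangentSpace I x)) : Prop where
  smooth : IsSmoothConnection cov
  leftInvariant : IsLeftInvariantConnection cov
  torsionFree : IsTorsionFree cov
  flat : IsFlatConnection cov

end Invariance

/-- A smooth real Lie group has the differentiability that Mathlib asks for to put the Lie bracket
on `GroupLieAlgebra I G`. -/
instance instLieGroupMinSmoothness [LieGroup I ∞ G] : LieGroup I (minSmoothness ℝ 3) G :=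
  LieGroup.of_le (n := ∞) (by
    rw [minSmoothness_of_isRCLikeNormedField]
    exact WithTop.coe_le_coe.2 (le_top : (3 : ℕ∞) ≤ ⊤))

/-- A quadratic Lie group `(G, k)` is undecomposable when `k` is degenerate on every ideal of the
Lie algebra of `G` other than zero and the whole algebra. -/
def IsUndecomposable [CompleteSpace E] [LieGroup I ∞ G] [IsManifold I 1 G]
    (k : SemiRiemannianMetric I G) : Prop :=
  ∀ J : LieIdeal ℝ (GroupLieAlgebra I G), J ≠ ⊥ → J ≠ ⊤ →
    ∃ x ∈ J, x ≠ 0 ∧ ∀ y ∈ J, k.form (1 : G) x y = 0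

end Groups

end QuadraticLie

end

noncomputable section

namespace QuadraticLie

section Geometry

open VectorField Filter Topology Bundle

section Commutator

variable {E : Type*} [NormedAddCommGroup E] [NormedSpace ℝ E]
  {H : Type*} [TopologicalSpace H] {I : ModelWithCorners ℝ E H}
  {M : Type*} [TopologicalSpace M] [ChartedSpace H M]
  {F : Type*} [NormedAddCommGroup F] [NormedSpace ℝ F]

/-- The derivative of a smooth function along a smooth vector field is smooth. -/
lemma contMDiffAt_mvfderiv_apply [IsManifold I ∞ M] {m n : ℕ∞} {X : Π x : M, TangentSpace I x}
    {f : M → F} {x : M} (hX : CMDiffAt m (T% X) x) (hf : CMDiffAt n f x) (hmn : m + 1 ≤ n) :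
    CMDiffAt m (fun y ↦ d% f y (X y)) x := by
  have hle : (m : ℕ∞ω) + 1 ≤ n := by exact_mod_cast hmn
  have : IsManifold I (n : ℕ∞ω) M := IsManifold.of_le (n := ∞) (by exact_mod_cast le_top)
  have : IsManifold I ((m : ℕ∞ω) + 1) M := IsManifold.of_le (n := ∞) (by exact_mod_cast le_top)
  have h1 := ContMDiffAt.mfderiv_const hf hle
  have h2 := ContMDiffAt.clm_apply_of_inCoordinates (b₂ := f) h1 hX (hf.of_le (le_self_add.trans hle))
  exact (contMDiff_snd_tangentBundle_modelSpace F 𝓘(ℝ, F)).contMDiffAt.comp x h2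

lemma mvfderiv_comp_apply' {N : Type*} {E' : Type*} [NormedAddCommGroup E']
    [NormedSpace ℝ E'] {H' : Type*} [TopologicalSpace H'] {J : ModelWithCorners ℝ E' H'}
    [TopologicalSpace N] [ChartedSpace H' N] {f : N → F} {Φ : M → N} {x : M}
    (hf : MDiffAt f (Φ x)) (hΦ : MDiffAt Φ x) (v : TangentSpace I x) :
    d% (f ∘ Φ) x v = d% f (Φ x) (mfderiv I J Φ x v) :=
  mfderiv_comp_apply x hf hΦ v

lemma mvfderiv_clm_comp_apply {F' : Type*} [NormedAddCommGroup F'] [NormedSpace ℝ F']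
    {f : M → F} {x : M} (ℓ : F →L[ℝ] F') (hf : MDiffAt f x) (v : TangentSpace I x) :
    d% (fun y ↦ ℓ (f y)) x v = ℓ (d% f x v) := by
  have h := mvfderiv_comp_apply' (f := ℓ) (Φ := f) (x := x)
    ℓ.differentiableAt.mdifferentiableAt hf v
  refine h.trans ?_
  have : mfderiv 𝓘(ℝ, F) 𝓘(ℝ, F') ℓ (f x) = ℓ := by
    rw [mfderiv_eq_fderiv]; exact ℓ.fderiv
  change mfderiv 𝓘(ℝ, F) 𝓘(ℝ, F') ℓ (f x) _ = _
  rw [this]; rfl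

lemma mvfderiv_congr {f g : M → F} {x : M} (h : f =ᶠ[𝓝 x] g) (v : TangentSpace I x) :
    d% f x v = d% g x v := by
  have : mfderiv I 𝓘(ℝ, F) f x v = mfderiv I 𝓘(ℝ, F) g x v := by rw [h.mfderiv_eq]; rfl
  exact this

variable [IsManifold I ∞ M]

lemma eventually_mdifferentiableAt {M' : Type*} {E' : Type*} [NormedAddCommGroup E']
    [NormedSpace ℝ E'] {H' : Type*} [TopologicalSpace H'] {J : ModelWithCorners ℝ E' H'}
    [TopologicalSpace M'] [ChartedSpace H' M'] [IsManifold J ∞ M']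
    {f : M → M'} {x : M} (hf : CMDiffAt ∞ f x) : ∀ᶠ y in 𝓝 x, MDiffAt f y := by
  have : IsManifold I 1 M := IsManifold.of_le (n := ∞) (by exact_mod_cast le_top)
  have : IsManifold J 1 M' := IsManifold.of_le (n := ∞) (by exact_mod_cast le_top)
  have h1 : CMDiffAt 1 f x := hf.of_le (by exact_mod_cast le_top)
  filter_upwards [(contMDiffAt_iff_contMDiffAt_nhds (by simp)).1 h1] with y hy
  exact hy.mdifferentiableAt one_ne_zero

variable [CompleteSpace E]

omit [CompleteSpace E] in
variable (I M) in
lemma isManifold_minSmoothness : IsManifold I (minSmoothness ℝ 3) M :=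
  IsManifold.of_le (n := ∞) (by
    rw [minSmoothness_of_isRCLikeNormedField]
    exact WithTop.coe_le_coe.2 (le_top : (3 : ℕ∞) ≤ ⊤))

attribute [local instance] isManifold_minSmoothness

lemma contMDiffAt_mlieBracket {X Y : Π x : M, TangentSpace I x} {x : M}
    (hX : CMDiffAt ∞ (T% X) x) (hY : CMDiffAt ∞ (T% Y) x) :
    CMDiffAt ∞ (T% (mlieBracket I X Y)) x := by
  have : IsManifold I (((⊤ : ℕ∞) : ℕ∞ω) + 1) M := IsManifold.of_le (n := ∞) le_rfl
  refine ContMDiffAt.mlieBracket_vectorField (m := ⊤) (n := ⊤) hX hY ?_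
  rw [minSmoothness_of_isRCLikeNormedField]; rfl

/-- The Lie bracket of two vector fields acts on functions as the commutator of derivations. -/
lemma mvfderiv_mlieBracket_apply_real {X Y : Π x : M, TangentSpace I x} {f : M → ℝ} {x : M}
    (hX : CMDiffAt ∞ (T% X) x) (hY : CMDiffAt ∞ (T% Y) x) (hf : CMDiffAt ∞ f x) :
    d% f x (mlieBracket I X Y x) =
      d% (fun y ↦ d% f y (Y y)) x (X x) - d% (fun y ↦ d% f y (X y)) x (Y x) := by
  have h2 : minSmoothness ℝ 2 ≤ (∞ : ℕ∞ω) := by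
    rw [minSmoothness_of_isRCLikeNormedField]; exact WithTop.coe_le_coe.2 (le_top : (2 : ℕ∞) ≤ ⊤)
  rcases subsingleton_or_nontrivial E with hE | hE
  · have hs : Subsingleton (TangentSpace I x) := hE
    rw [Subsingleton.elim (mlieBracket I X Y x) 0, Subsingleton.elim (X x) 0,
      Subsingleton.elim (Y x) 0]
    simp
  obtain ⟨w, hw⟩ : ∃ w : TangentSpace I x, w ≠ 0 := exists_ne (α := E) 0
  have : IsManifold I (((⊤ : ℕ∞) : ℕ∞ω) + 1) M := IsManifold.of_le (n := ∞) le_rfl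
  set W : Π x : M, TangentSpace I x := FiberBundle.extend E w with hWdef
  have hWx : W x = w := FiberBundle.extend_apply_self E w
  have hW : CMDiffAt ∞ (T% W) x := FiberBundle.contMDiffAt_extend ..
  have key : ∀ {Z : Π x : M, TangentSpace I x}, CMDiffAt ∞ (T% Z) x →
      mlieBracket I Z (f • W) =ᶠ[𝓝 x]
        (fun y ↦ d% f y (Z y)) • W + f • mlieBracket I Z W := by
    intro Z hZ
    filter_upwards [eventually_mdifferentiableAt hf, eventually_mdifferentiableAt hW] with y h1 h2
    exact mlieBracket_smul_right h1 h2
  have expand : ∀ {U Z : Π x : M, TangentSpace I x}, CMDiffAt ∞ (T% U) x → CMDiffAt ∞ (T% Z) x →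
      mlieBracket I U (mlieBracket I Z (f • W)) x =
        d% (fun y ↦ d% f y (Z y)) x (U x) • W x + d% f x (Z x) • mlieBracket I U W x
        + (d% f x (U x) • mlieBracket I Z W x + f x • mlieBracket I U (mlieBracket I Z W) x) := by
    intro U Z hU hZ
    have hZf : CMDiffAt ∞ (fun y ↦ d% f y (Z y)) x :=
      contMDiffAt_mvfderiv_apply (m := ⊤) (n := ⊤) hZ hf (by simp)
    have hZW := contMDiffAt_mlieBracket hZ hW
    rw [Filter.EventuallyEq.mlieBracket_vectorField_eq (V₁ := U) (V := U)
        (Eventually.of_forall fun _ ↦ rfl) (key hZ),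
      mlieBracket_add_right, mlieBracket_smul_right, mlieBracket_smul_right]
    · exact hf.mdifferentiableAt (by simp)
    · exact hZW.mdifferentiableAt (by simp)
    · exact hZf.mdifferentiableAt (by simp)
    · exact hW.mdifferentiableAt (by simp)
    · exact (hZf.smul_section hW).mdifferentiableAt (by simp)
    · exact (hf.smul_section hZW).mdifferentiableAt (by simp)
  have L1 := leibniz_identity_mlieBracket_apply (hX.of_le h2) (hY.of_le h2)
    ((hf.smul_section hW).of_le h2)
  have L2 := leibniz_identity_mlieBracket_apply (hX.of_le h2) (hY.of_le h2) (hW.of_le h2)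
  change mlieBracket I X (mlieBracket I Y (f • W)) x = mlieBracket I (mlieBracket I X Y) (f • W) x
    + mlieBracket I Y (mlieBracket I X (f • W)) x at L1
  rw [expand hX hY, expand hY hX, mlieBracket_smul_right (hf.mdifferentiableAt (by simp))
    (hW.mdifferentiableAt (by simp)), L2] at L1
  have hz : (d% f x (mlieBracket I X Y x) -
      (d% (fun y ↦ d% f y (Y y)) x (X x) - d% (fun y ↦ d% f y (X y)) x (Y x))) • W x = 0 := by
    rw [sub_smul, sub_smul]
    rw [← sub_eq_zero] at L1
    rw [← neg_eq_zero, ← L1]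
    module
  have hne : W x ≠ 0 := by rw [hWx]; exact hw
  exact sub_eq_zero.1 ((smul_eq_zero.1 hz).resolve_right hne)

/-- The Lie bracket of two vector fields acts on vector-valued functions as the commutator of
derivations. -/
lemma mvfderiv_mlieBracket_apply {X Y : Π x : M, TangentSpace I x} {f : M → F} {x : M}
    (hX : CMDiffAt ∞ (T% X) x) (hY : CMDiffAt ∞ (T% Y) x) (hf : CMDiffAt ∞ f x) :
    d% f x (mlieBracket I X Y x) =
      d% (fun y ↦ d% f y (Y y)) x (X x) - d% (fun y ↦ d% f y (X y)) x (Y x) := by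
  refine (SeparatingDual.eq_iff_forall_dual_eq (R := ℝ)).2 ?_
  intro ℓ
  have hℓ : ∀ {Z : Π x : M, TangentSpace I x}, CMDiffAt ∞ (T% Z) x → ∀ v : TangentSpace I x,
      ℓ (d% (fun y ↦ d% f y (Z y)) x v) = d% (fun y ↦ d% (fun z ↦ ℓ (f z)) y (Z y)) x v := by
    intro Z hZ v
    have hZf : CMDiffAt ∞ (fun y ↦ d% f y (Z y)) x :=
      contMDiffAt_mvfderiv_apply (m := ⊤) (n := ⊤) hZ hf (by simp)
    rw [← mvfderiv_clm_comp_apply ℓ (hZf.mdifferentiableAt (by simp))]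
    refine mvfderiv_congr ?_ v
    filter_upwards [eventually_mdifferentiableAt hf] with y hy
    rw [mvfderiv_clm_comp_apply ℓ hy]
  rw [map_sub, hℓ hX, hℓ hY, ← mvfderiv_clm_comp_apply ℓ (hf.mdifferentiableAt (by simp))]
  exact mvfderiv_mlieBracket_apply_real hX hY (ℓ.contDiff.contMDiff.contMDiffAt.comp x hf)

/-- The Lie bracket is natural with respect to related vector fields. -/
lemma mfderiv_mlieBracket_of_related {N : Type*} {E' : Type*} [NormedAddCommGroup E']
    [NormedSpace ℝ E'] {H' : Type*} [TopologicalSpace H'] {J : ModelWithCorners ℝ E' H'}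
    [TopologicalSpace N] [ChartedSpace H' N] [IsManifold J ∞ N] [CompleteSpace E']
    {Φ : M → N} {x : M} {A B : Π x : M, TangentSpace I x} {A' B' : Π y : N, TangentSpace J y}
    (hΦ : CMDiffAt ∞ Φ x) (hA : CMDiffAt ∞ (T% A) x) (hB : CMDiffAt ∞ (T% B) x)
    (hA' : CMDiffAt ∞ (T% A') (Φ x)) (hB' : CMDiffAt ∞ (T% B') (Φ x))
    (hAA' : ∀ᶠ y in 𝓝 x, mfderiv I J Φ y (A y) = A' (Φ y))
    (hBB' : ∀ᶠ y in 𝓝 x, mfderiv I J Φ y (B y) = B' (Φ y)) :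
    mfderiv I J Φ x (mlieBracket I A B x) = mlieBracket J A' B' (Φ x) := by
  have : IsManifold J 1 N := IsManifold.of_le (n := ∞) (by exact_mod_cast le_top)
  set φ : N → E' := ↑(extChartAt J (Φ x))
  have hφ : CMDiffAt ∞ φ (Φ x) := contMDiffAt_extChartAt
  have hφΦ : CMDiffAt ∞ (φ ∘ Φ) x := hφ.comp x hΦ
  have hinj : Function.Injective (d% φ (Φ x)) :=
    (isInvertible_mfderiv_extChartAt (mem_extChartAt_source (I := J) (Φ x))).injective
  apply hinj
  have second : ∀ {C D : Π x : M, TangentSpace I x} {C' D' : Π y : N, TangentSpace J y},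
      CMDiffAt ∞ (T% D') (Φ x) →
      (∀ᶠ y in 𝓝 x, mfderiv I J Φ y (C y) = C' (Φ y)) →
      (∀ᶠ y in 𝓝 x, mfderiv I J Φ y (D y) = D' (Φ y)) →
      d% (fun y ↦ d% (φ ∘ Φ) y (D y)) x (C x) =
        d% (fun z ↦ d% φ z (D' z)) (Φ x) (C' (Φ x)) := by
    intro C D C' D' hD' hC hD
    have hDφ : CMDiffAt ∞ (fun z ↦ d% φ z (D' z)) (Φ x) :=
      contMDiffAt_mvfderiv_apply (m := ⊤) (n := ⊤) hD' hφ (by simp)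
    rw [← hC.self_of_nhds, ← mvfderiv_comp_apply' (hDφ.mdifferentiableAt (by simp))
      (hΦ.mdifferentiableAt (by simp))]
    refine mvfderiv_congr ?_ _
    filter_upwards [hD, eventually_mdifferentiableAt hΦ,
      hΦ.continuousAt.eventually (eventually_mdifferentiableAt hφ)] with y h1 h2 h3
    rw [mvfderiv_comp_apply' h3 h2, h1]; rfl
  rw [← mvfderiv_comp_apply' (hφ.mdifferentiableAt (by simp)) (hΦ.mdifferentiableAt (by simp)),
    mvfderiv_mlieBracket_apply hA hB hφΦ, mvfderiv_mlieBracket_apply hA' hB' hφ,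
    second hB' hAA' hBB', second hA' hBB' hAA']

end Commutator

section InvariantFields

variable {E : Type*} [NormedAddCommGroup E] [NormedSpace ℝ E]
  {H : Type*} [TopologicalSpace H] {I : ModelWithCorners ℝ E H}
  {G : Type*} [TopologicalSpace G] [ChartedSpace H G] [Group G] [LieGroup I ∞ G]

lemma mdifferentiableAt_mul (p : G × G) :
    MDifferentiableAt (I.prod I) I (fun q : G × G ↦ q.1 * q.2) p :=
  (contMDiff_mul I ∞).mdifferentiableAt (by simp)

lemma mdifferentiableAt_mul_left (a x : G) : MDifferentiableAt I I (fun y ↦ a * y) x :=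
  (contMDiff_mul_left (I := I) (n := ∞)).mdifferentiableAt (by simp)

lemma mdifferentiableAt_mul_right (a x : G) : MDifferentiableAt I I (fun y ↦ y * a) x :=
  (contMDiff_mul_right (I := I) (n := ∞)).mdifferentiableAt (by simp)

variable (I) in
/-- The vector field on `G × G` with components `A` and `B`. -/
def prodField (A B : Π x : G, TangentSpace I x) (p : G × G) : TangentSpace (I.prod I) p :=
  (A p.1, B p.2)

lemma contMDiffAt_prodField {A B : Π x : G, TangentSpace I x} {p : G × G}
    (hA : CMDiffAt ∞ (T% A) p.1) (hB : CMDiffAt ∞ (T% B) p.2) :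
    ContMDiffAt (I.prod I) (I.prod I).tangent ∞
      (fun q ↦ (⟨q, prodField I A B q⟩ : TangentBundle (I.prod I) (G × G))) p := by
  have h1 : ContMDiffAt (I.prod I) (I.tangent.prod I.tangent) ∞
      (fun q : G × G ↦ ((⟨q.1, A q.1⟩, ⟨q.2, B q.2⟩) : TangentBundle I G × TangentBundle I G)) p :=
    (hA.comp p contMDiffAt_fst).prodMk (hB.comp p contMDiffAt_snd)
  exact (contMDiff_equivTangentBundleProd_symm (I := I) (M := G) (I' := I) (M' := G)
    (n := ∞)).contMDiffAt.comp p h1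

lemma mfderiv_mul_prodField (A B : Π x : G, TangentSpace I x) (p : G × G) :
    mfderiv (I.prod I) I (fun q : G × G ↦ q.1 * q.2) p (prodField I A B p) =
      mfderiv I I (fun y ↦ y * p.2) p.1 (A p.1) + mfderiv I I (fun y ↦ p.1 * y) p.2 (B p.2) :=
  mfderiv_prod_eq_add_apply (mdifferentiableAt_mul p)

/-- The derivative of the multiplication along smooth families of tangent vectors is smooth. -/
lemma contMDiffAt_mfderiv_mul {E' : Type*} [NormedAddCommGroup E'] [NormedSpace ℝ E']
    {H' : Type*} [TopologicalSpace H'] {J : ModelWithCorners ℝ E' H'}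
    {N : Type*} [TopologicalSpace N] [ChartedSpace H' N]
    {f g : N → TangentBundle I G} {x : N} (hf : CMDiffAt ∞ f x) (hg : CMDiffAt ∞ g x) :
    CMDiffAt ∞ (fun y ↦ (⟨(f y).1 * (g y).1, mfderiv I I (fun z ↦ z * (g y).1) (f y).1 (f y).2
      + mfderiv I I (fun z ↦ (f y).1 * z) (g y).1 (g y).2⟩ : TangentBundle I G)) x := by
  have h1 : ContMDiffAt J (I.prod I).tangent ∞
      (fun y ↦ (⟨((f y).1, (g y).1), ((f y).2, (g y).2)⟩ : TangentBundle (I.prod I) (G × G))) x :=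
    (contMDiff_equivTangentBundleProd_symm (I := I) (M := G) (I' := I) (M' := G)
      (n := ∞)).contMDiffAt.comp x (hf.prodMk hg)
  have h2 := ((contMDiff_mul I ∞ (G := G)).contMDiff_tangentMap (m := ∞) le_rfl).contMDiffAt.comp
    x h1
  refine h2.congr_of_eventuallyEq (Eventually.of_forall fun y ↦ ?_)
  refine Bundle.TotalSpace.ext rfl (heq_of_eq ?_)
  exact (mfderiv_prod_eq_add_apply (I := I) (I' := I) (I'' := I)
    (v := (show TangentSpace (I.prod I) ((f y).1, (g y).1) from ((f y).2, (g y).2)))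
    (mdifferentiableAt_mul (I := I) ((f y).1, (g y).1))).symm

lemma contMDiff_mulInvariant (v : GroupLieAlgebra I G) :
    CMDiff ∞ (T% (mulInvariantVectorField v : Π x : G, TangentSpace I x)) := by
  intro x
  have h1 : CMDiffAt ∞ (fun y : G ↦ (⟨y, 0⟩ : TangentBundle I G)) x :=
    (contMDiff_zeroSection ℝ (TangentSpace I : G → Type _)).contMDiffAt
  have h2 : CMDiffAt ∞ (fun _ : G ↦ (⟨1, v⟩ : TangentBundle I G)) x := contMDiffAt_const
  refine (contMDiffAt_mfderiv_mul h1 h2).congr_of_eventuallyEq (Eventually.of_forall fun y ↦ ?_)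
  refine Bundle.TotalSpace.ext (mul_one y).symm (heq_of_eq ?_)
  simp [mulInvariantVectorField]
  rfl

/-- The right invariant vector field with value `v` at the identity. -/
def rightInvariantField (v : GroupLieAlgebra I G) (x : G) : TangentSpace I x :=
  mfderiv I I (fun y ↦ y * x) 1 v

lemma contMDiff_rightInvariantField (v : GroupLieAlgebra I G) :
    CMDiff ∞ (T% (rightInvariantField v : Π x : G, TangentSpace I x)) := by
  intro x
  have h1 : CMDiffAt ∞ (fun y : G ↦ (⟨y, 0⟩ : TangentBundle I G)) x :=
    (contMDiff_zeroSection ℝ (TangentSpace I : G → Type _)).contMDiffAt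
  have h2 : CMDiffAt ∞ (fun _ : G ↦ (⟨1, v⟩ : TangentBundle I G)) x := contMDiffAt_const
  refine (contMDiffAt_mfderiv_mul h2 h1).congr_of_eventuallyEq (Eventually.of_forall fun y ↦ ?_)
  refine Bundle.TotalSpace.ext (one_mul y).symm (heq_of_eq ?_)
  simp [rightInvariantField]
  rfl

lemma mfderiv_mul_left_mulInvariant (v : GroupLieAlgebra I G) (a x : G) :
    mfderiv I I (fun y ↦ a * y) x (mulInvariantVectorField v x) =
      mulInvariantVectorField v (a * x) := by
  have h : (fun y : G ↦ a * x * y) = (fun y ↦ a * y) ∘ (fun y ↦ x * y) := by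
    ext y; simp [mul_assoc]
  have h2 := mfderiv_comp_apply_of_eq (I := I) (I' := I) (I'' := I) (1 : G) (y := x)
    (mdifferentiableAt_mul_left a x) (mdifferentiableAt_mul_left x 1) (mul_one x) v
  refine h2.symm.trans ?_
  rw [← h]; rfl

lemma mfderiv_mul_right_rightInvariantField (v : GroupLieAlgebra I G) (a x : G) :
    mfderiv I I (fun y ↦ y * a) x (rightInvariantField v x) = rightInvariantField v (x * a) := by
  have h : (fun y : G ↦ y * (x * a)) = (fun y ↦ y * a) ∘ (fun y ↦ y * x) := by
    ext y; simp [mul_assoc]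
  have h2 := mfderiv_comp_apply_of_eq (I := I) (I' := I) (I'' := I) (1 : G) (y := x)
    (mdifferentiableAt_mul_right a x) (mdifferentiableAt_mul_right x 1) (one_mul x) v
  refine h2.symm.trans ?_
  rw [← h]; rfl

variable [CompleteSpace E]

/-- Left and right invariant vector fields commute. -/
lemma mlieBracket_rightInvariantField_mulInvariant (v w : GroupLieAlgebra I G) :
    mlieBracket I (rightInvariantField v) (mulInvariantVectorField w) (1 : G) = 0 := by
  let A := prodField I (rightInvariantField v : Π x : G, TangentSpace I x) 0
  let B := prodField I 0 (mulInvariantVectorField w : Π x : G, TangentSpace I x)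
  have hv : ∀ x : G, CMDiffAt ∞ (T% (rightInvariantField v : Π x : G, TangentSpace I x)) x :=
    fun x ↦ (contMDiff_rightInvariantField v).contMDiffAt
  have hw : ∀ x : G, CMDiffAt ∞ (T% (mulInvariantVectorField w : Π x : G, TangentSpace I x)) x :=
    fun x ↦ (contMDiff_mulInvariant w).contMDiffAt
  have h0 : ∀ x : G, CMDiffAt ∞ (T% (0 : Π x : G, TangentSpace I x)) x :=
    fun x ↦ (contMDiff_zeroSection ℝ (TangentSpace I : G → Type _)).contMDiffAt
  have hA := contMDiffAt_prodField (p := ((1, 1) : G × G)) (hv 1) (h0 1)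
  have hB := contMDiffAt_prodField (p := ((1, 1) : G × G)) (h0 1) (hw 1)
  have hfst : mfderiv (I.prod I) I Prod.fst ((1, 1) : G × G) (mlieBracket (I.prod I) A B (1, 1))
      = 0 := by
    rw [mfderiv_mlieBracket_of_related (A := A) (B := B) (A' := rightInvariantField v) (B' := 0)
      contMDiffAt_fst hA hB (hv _) (h0 _) (Eventually.of_forall fun y ↦ ?_)
      (Eventually.of_forall fun y ↦ ?_)]
    · simp
    · rw [mfderiv_fst]; rfl
    · rw [mfderiv_fst]; rfl
  have hsnd : mfderiv (I.prod I) I Prod.snd ((1, 1) : G × G) (mlieBracket (I.prod I) A B (1, 1))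
      = 0 := by
    rw [mfderiv_mlieBracket_of_related (A := A) (B := B) (A' := 0) (B' := mulInvariantVectorField w)
      contMDiffAt_snd hA hB (h0 _) (hw _) (Eventually.of_forall fun y ↦ ?_)
      (Eventually.of_forall fun y ↦ ?_)]
    · simp
    · rw [mfderiv_snd]; rfl
    · rw [mfderiv_snd]; rfl
  have hAB : mlieBracket (I.prod I) A B (1, 1) = 0 := by
    rw [mfderiv_fst] at hfst
    rw [mfderiv_snd] at hsnd
    exact Prod.ext hfst hsnd
  have hmul := mfderiv_mlieBracket_of_related (Φ := fun q : G × G ↦ q.1 * q.2) (x := (1, 1))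
    (A := A) (B := B) (A' := rightInvariantField v) (B' := mulInvariantVectorField w)
    (contMDiff_mul I ∞).contMDiffAt hA hB (hv _) (hw _) (Eventually.of_forall fun y ↦ ?_)
    (Eventually.of_forall fun y ↦ ?_)
  · rw [hAB, map_zero] at hmul
    have base : ∀ z : G, z = 1 →
        0 = mlieBracket I (rightInvariantField v) (mulInvariantVectorField w) z →
        mlieBracket I (rightInvariantField v) (mulInvariantVectorField w) (1 : G) = 0 := by
      rintro _ rfl h; exact h.symm
    exact base _ (mul_one 1) hmul
  · rw [mfderiv_mul_prodField]
    simp [mfderiv_mul_right_rightInvariantField]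
  · rw [mfderiv_mul_prodField]
    simp [mfderiv_mul_left_mulInvariant]

end InvariantFields

section LeftTrivialization

variable {E : Type*} [NormedAddCommGroup E] [NormedSpace ℝ E]
  {H : Type*} [TopologicalSpace H] {I : ModelWithCorners ℝ E H}
  {G : Type*} [TopologicalSpace G] [ChartedSpace H G] [Group G]

variable (I) in
/-- The derivative at `1` of the left translation by `x`. -/
def leftFrame (x : G) : E →L[ℝ] TangentSpace I x :=
  mfderiv I I (fun y ↦ x * y) (1 : G)

variable (I) in
/-- The left Maurer-Cartan form. -/
def leftCoord (x : G) : TangentSpace I x →L[ℝ] E :=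
  mfderiv I I (fun y ↦ x⁻¹ * y) x

/-- The expression of a vector field in the left trivialization of the tangent bundle. -/
def leftCoords (X : Π x : G, TangentSpace I x) (x : G) : E :=
  leftCoord I x (X x)

lemma leftFrame_one (v : E) : leftFrame I (1 : G) v = v := by
  have : (fun y : G ↦ 1 * y) = id := by ext; simp
  unfold leftFrame
  rw [this, mfderiv_id]; rfl

lemma leftCoord_one (v : TangentSpace I (1 : G)) : leftCoord I (1 : G) v = v := by
  have : (fun y : G ↦ (1 : G)⁻¹ * y) = id := by ext; simp
  unfold leftCoord
  rw [this, mfderiv_id]; rfl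

variable [LieGroup I ∞ G]

lemma leftCoord_mfderiv_mul_left (a x : G) (v : TangentSpace I x) :
    leftCoord I (a * x) (mfderiv I I (fun y ↦ a * y) x v) = leftCoord I x v := by
  have h : (fun y : G ↦ x⁻¹ * y) = (fun y ↦ (a * x)⁻¹ * y) ∘ (fun y ↦ a * y) := by
    ext y; simp [mul_assoc]
  have h2 := mfderiv_comp_apply (I := I) (I' := I) (I'' := I) x
    (mdifferentiableAt_mul_left (a * x)⁻¹ (a * x)) (mdifferentiableAt_mul_left a x) v
  refine h2.symm.trans ?_
  rw [← h]; rfl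

lemma leftFrame_eq_mfderiv (a x : G) (v : E) :
    mfderiv I I (fun y ↦ a * y) x (leftFrame I x v) = leftFrame I (a * x) v :=
  mfderiv_mul_left_mulInvariant v a x

@[simp]
lemma leftCoord_leftFrame (x : G) (v : E) : leftCoord I x (leftFrame I x v) = v := by
  have h2 := mfderiv_comp_apply_of_eq (I := I) (I' := I) (I'' := I) (1 : G) (y := x)
    (mdifferentiableAt_mul_left x⁻¹ x) (mdifferentiableAt_mul_left x 1) (mul_one x) v
  have h : (fun y : G ↦ x⁻¹ * y) ∘ (fun y ↦ x * y) = id := by ext y; simp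
  refine h2.symm.trans ?_
  rw [h, mfderiv_id]; rfl

@[simp]
lemma leftFrame_leftCoord (x : G) (v : TangentSpace I x) :
    leftFrame I x (leftCoord I x v) = v := by
  have h2 := mfderiv_comp_apply_of_eq (I := I) (I' := I) (I'' := I) x (y := 1)
    (mdifferentiableAt_mul_left x 1) (mdifferentiableAt_mul_left x⁻¹ x) (inv_mul_cancel x) v
  have h : (fun y : G ↦ x * y) ∘ (fun y ↦ x⁻¹ * y) = id := by ext y; simp
  refine h2.symm.trans ?_
  rw [h, mfderiv_id]; rfl

lemma leftCoord_injective (x : G) : Function.Injective (leftCoord I x) :=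
  Function.LeftInverse.injective (leftFrame_leftCoord x)

@[simp]
lemma leftCoords_leftFrame (v : E) (x : G) :
    leftCoords (fun y ↦ leftFrame I y v) x = v :=
  leftCoord_leftFrame x v

lemma trivializationAt_one_snd (v : TangentSpace I (1 : G)) :
    (trivializationAt E (TangentSpace I) (1 : G) ⟨1, v⟩).2 = v := by
  rw [TangentBundle.trivializationAt_apply]
  exact (tangentBundleCore I G).coordChange_self (achart H (1 : G)) 1
    (mem_chart_source H (1 : G)) v

lemma contMDiff_leftCoord_totalSpace :
    ContMDiff I.tangent 𝓘(ℝ, E) ∞ (fun p : TangentBundle I G ↦ leftCoord I p.1 p.2) := by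
  intro p
  have h1 : ContMDiffAt I.tangent I.tangent ∞
      (fun q : TangentBundle I G ↦ (⟨q.1⁻¹, 0⟩ : TangentBundle I G)) p :=
    ((contMDiff_zeroSection ℝ (TangentSpace I : G → Type _)).comp
      ((contMDiff_inv I ∞).comp (contMDiff_proj (TangentSpace I : G → Type _)))).contMDiffAt
  have h2 := contMDiffAt_mfderiv_mul h1 (contMDiffAt_id (x := p))
  have h3 : ContMDiffAt I.tangent I.tangent ∞
      (fun q : TangentBundle I G ↦ (⟨1, leftCoord I q.1 q.2⟩ : TangentBundle I G)) p := by
    refine h2.congr_of_eventuallyEq (Eventually.of_forall fun q ↦ ?_)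
    refine Bundle.TotalSpace.ext (inv_mul_cancel q.1).symm (heq_of_eq ?_)
    simp [leftCoord]
    rfl
  refine (contMDiffAt_totalSpace.1 h3).2.congr_of_eventuallyEq (Eventually.of_forall fun q ↦ ?_)
  exact (trivializationAt_one_snd _).symm

lemma contMDiffAt_leftCoords {X : Π x : G, TangentSpace I x} {x : G}
    (hX : CMDiffAt ∞ (T% X) x) : CMDiffAt ∞ (leftCoords X) x :=
  contMDiff_leftCoord_totalSpace.contMDiffAt.comp x hX

lemma mdifferentiableAt_leftCoords {X : Π x : G, TangentSpace I x} {x : G}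
    (hX : MDiffAt (T% X) x) : MDiffAt (leftCoords X) x :=
  (contMDiff_leftCoord_totalSpace.mdifferentiableAt (by simp)).comp x hX

lemma contMDiffAt_leftFrame {f : G → E} {x : G} (hf : CMDiffAt ∞ f x) :
    CMDiffAt ∞ (T% (fun y ↦ leftFrame I y (f y))) x := by
  have h1 : CMDiffAt ∞ (fun y : G ↦ (⟨y, 0⟩ : TangentBundle I G)) x :=
    (contMDiff_zeroSection ℝ (TangentSpace I : G → Type _)).contMDiffAt
  have h2 : CMDiffAt ∞ (fun y : G ↦ (⟨1, f y⟩ : TangentBundle I G)) x := by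
    refine contMDiffAt_totalSpace.2 ⟨contMDiffAt_const, ?_⟩
    refine hf.congr_of_eventuallyEq (Eventually.of_forall fun y ↦ ?_)
    exact trivializationAt_one_snd _
  refine (contMDiffAt_mfderiv_mul h1 h2).congr_of_eventuallyEq (Eventually.of_forall fun y ↦ ?_)
  refine Bundle.TotalSpace.ext (mul_one y).symm (heq_of_eq ?_)
  simp [leftFrame]
  rfl

end LeftTrivialization

section HomSmooth

variable {E : Type*} [NormedAddCommGroup E] [NormedSpace ℝ E] [FiniteDimensional ℝ E]
  {H : Type*} [TopologicalSpace H] {I : ModelWithCorners ℝ E H}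
  {M : Type*} [TopologicalSpace M] [ChartedSpace H M] [IsManifold I ∞ M]

/-- A field of endomorphisms of the tangent spaces is smooth if it maps smooth vector fields to
smooth vector fields. -/
lemma contMDiffAt_hom_of_apply {ϕ : Π x : M, TangentSpace I x →L[ℝ] TangentSpace I x} {x : M}
    [IsManifold I 1 M]
    (h : ∀ X : Π x : M, TangentSpace I x, CMDiffAt ∞ (T% X) x →
      CMDiffAt ∞ (T% (fun y ↦ ϕ y (X y))) x) :
    ContMDiffAt I (I.prod 𝓘(ℝ, E →L[ℝ] E)) ∞ (fun y ↦ (⟨y, ϕ y⟩ :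
      TotalSpace (E →L[ℝ] E) fun x : M ↦ TangentSpace I x →L[ℝ] TangentSpace I x)) x := by
  have : IsManifold I (((⊤ : ℕ∞) : ℕ∞ω) + 1) M := IsManifold.of_le (n := ∞) le_rfl
  refine (contMDiffAt_hom_bundle _).2 ⟨contMDiffAt_id, ?_⟩
  let b := Module.finBasis ℝ E
  let e := trivializationAt E (TangentSpace I) x
  let X : Fin _ → Π y : M, TangentSpace I y := fun i ↦ FiberBundle.extend E (e.symm x (b i))
  have hX : ∀ i, CMDiffAt ∞ (fun y ↦ (e ⟨y, ϕ y (X i y)⟩).2) x := fun i ↦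
    (contMDiffAt_section x).1 (h (X i) (FiberBundle.contMDiffAt_extend ..))
  have hsum : CMDiffAt ∞ (fun y ↦ ∑ i, ContinuousLinearMap.smulRightL ℝ E E
      (LinearMap.toContinuousLinearMap (b.coord i)) (e ⟨y, ϕ y (X i y)⟩).2) x := by
    refine ContMDiffAt.sum fun i _ ↦ ?_
    exact (ContinuousLinearMap.contMDiff _).contMDiffAt.comp x (hX i)
  refine hsum.congr_of_eventuallyEq ?_
  filter_upwards [e.open_baseSet.mem_nhds (FiberBundle.mem_baseSet_trivializationAt' x)] with y hy
  have hXy : ∀ i, X i y = e.symmL ℝ y (b i) := by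
    intro i
    have h1 : (e ⟨x, e.symm x (b i)⟩).2 = b i := by
      rw [e.apply_mk_symm (FiberBundle.mem_baseSet_trivializationAt' x)]
    change e.symm y (e ⟨x, e.symm x (b i)⟩).2 = _
    rw [h1, e.symmL_apply hy]
  have hin : ∀ u : E, ContinuousLinearMap.inCoordinates E (TangentSpace I) E (TangentSpace I)
      x y x y (ϕ y) u = (e ⟨y, ϕ y (e.symmL ℝ y u)⟩).2 := by
    intro u
    change e.continuousLinearMapAt ℝ y (ϕ y (e.symmL ℝ y u)) = _
    rw [e.continuousLinearMapAt_apply (R := ℝ), e.coe_linearMapAt_of_mem hy]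
  refine ContinuousLinearMap.coe_injective (b.ext fun j ↦ ?_)
  change ContinuousLinearMap.inCoordinates E (TangentSpace I) E (TangentSpace I)
      x y x y (ϕ y) (b j) = _
  rw [hin]
  simp [hXy, Finsupp.single_apply, Finset.sum_ite_eq]

end HomSmooth

section Bilinear

variable {E : Type*} [NormedAddCommGroup E] [NormedSpace ℝ E]
  {H : Type*} [TopologicalSpace H] {I : ModelWithCorners ℝ E H}
  {M : Type*} [TopologicalSpace M] [ChartedSpace H M]

lemma mvfderiv_bilin_apply {F F' F'' : Type*} [NormedAddCommGroup F] [NormedSpace ℝ F]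
    [NormedAddCommGroup F'] [NormedSpace ℝ F'] [NormedAddCommGroup F''] [NormedSpace ℝ F'']
    (L : F →L[ℝ] F' →L[ℝ] F'') {f : M → F} {g : M → F'} {x : M} (hf : MDiffAt f x)
    (hg : MDiffAt g x) (v : TangentSpace I x) :
    d% (fun y ↦ L (f y) (g y)) x v = L (d% f x v) (g x) + L (f x) (d% g x v) := by
  have h : HasMFDerivAt I 𝓘(ℝ, F'') (fun y ↦ L (f y) (g y)) x
      (L.precompR E (f x) (d% g x) + L.precompL E (d% f x) (g x)) := by
    refine ⟨(L.continuous.continuousAt.comp hf.continuousAt).clm_apply hg.continuousAt, ?_⟩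
    have h1 := L.hasFDerivWithinAt_of_bilinear hf.hasMFDerivAt.2 hg.hasMFDerivAt.2
    simp only [writtenInExtChartAt, Function.comp, mfld_simps] at h1 ⊢
    exact h1
  have h2 : d% (fun y ↦ L (f y) (g y)) x v
      = (L.precompR E (f x) (d% g x) + L.precompL E (d% f x) (g x)) v :=
    congrArg (fun T : E →L[ℝ] F'' ↦ T v) h.mfderiv
  rw [h2, add_comm]
  rfl

end Bilinear

section LeftConnection

variable {E : Type*} [NormedAddCommGroup E] [NormedSpace ℝ E]
  {H : Type*} [TopologicalSpace H] {I : ModelWithCorners ℝ E H}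
  {G : Type*} [TopologicalSpace G] [ChartedSpace H G] [Group G]

variable (I G) in
/-- The Lie bracket of the Lie algebra of `G`, on the model space. -/
def modelBracket (u v : E) : E :=
  @Bracket.bracket (GroupLieAlgebra I G) (GroupLieAlgebra I G) _ u v

lemma leftCoords_add (X Y : Π x : G, TangentSpace I x) :
    leftCoords (X + Y) = leftCoords X + leftCoords Y := by
  ext x; exact map_add (leftCoord I x) _ _

lemma leftCoords_smul (f : G → ℝ) (X : Π x : G, TangentSpace I x) :
    leftCoords (f • X) = f • leftCoords X := by
  ext x; exact map_smul (leftCoord I x) _ _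

variable [LieGroup I ∞ G]

variable (I G) in
/-- The left invariant connection with `∇_X Y = L X Y` for left invariant fields `X` and `Y`. -/
def leftConnection (L : E →L[ℝ] E →L[ℝ] E) :
    CovariantDerivative I E (fun x : G ↦ TangentSpace I x) where
  toFun X x := (leftFrame I x).comp
    (mvfderiv I (leftCoords X) x + (L.flip (leftCoords X x)).comp (leftCoord I x))
  isCovariantDerivativeOnUniv :=
    { add := by
        intro X Y x hX hY _
        rw [leftCoords_add, mvfderiv_add (mdifferentiableAt_leftCoords hX)
          (mdifferentiableAt_leftCoords hY)]
        ext v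
        simp
        abel
      leibniz := by
        intro X f x hX hf _
        rw [leftCoords_smul, mvfderiv_smul hf (mdifferentiableAt_leftCoords hX)]
        ext v
        simp [leftCoords]
        abel }

lemma leftConnection_apply (L : E →L[ℝ] E →L[ℝ] E) (X : Π x : G, TangentSpace I x) (x : G)
    (v : TangentSpace I x) : leftConnection I G L X x v =
      leftFrame I x (d% (leftCoords X) x v + L (leftCoord I x v) (leftCoords X x)) := rfl

lemma leftCoord_leftConnection (L : E →L[ℝ] E →L[ℝ] E) (X : Π x : G, TangentSpace I x) (x : G)
    (v : TangentSpace I x) : leftCoord I x (leftConnection I G L X x v) =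
      d% (leftCoords X) x v + L (leftCoord I x v) (leftCoords X x) := by
  rw [leftConnection_apply, leftCoord_leftFrame]

lemma isLeftInvariantConnection_leftConnection (L : E →L[ℝ] E →L[ℝ] E) :
    IsLeftInvariantConnection (leftConnection I G L) := by
  intro a Y hY x v
  have hYd : MDiffAt (leftCoords Y) (a * x) :=
    (contMDiffAt_leftCoords (hY (a * x))).mdifferentiableAt (by simp)
  have hc : leftCoords (mpullback I I (fun y ↦ a * y) Y) = leftCoords Y ∘ (fun y ↦ a * y) := by
    ext y
    have h := leftCoord_mfderiv_mul_left (I := I) a⁻¹ (a * y) (Y (a * y))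
    have hbase : ∀ z : G, z = y → ∀ w : E, leftCoord I y w = leftCoord I z w := by
      rintro _ rfl w; rfl
    rw [Function.comp, leftCoords, leftCoords, ← h, mpullback_apply, inverse_mfderiv_mul_left]
    exact hbase _ (inv_mul_cancel_left a y) _
  rw [leftConnection_apply, leftConnection_apply, leftFrame_eq_mfderiv, hc,
    mvfderiv_comp_apply' hYd (mdifferentiableAt_mul_left a x), leftCoord_mfderiv_mul_left]
  rfl

variable [FiniteDimensional ℝ E]

lemma isSmoothConnection_leftConnection (L : E →L[ℝ] E →L[ℝ] E) :
    IsSmoothConnection (leftConnection I G L) := by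
  refine ⟨⟨fun {X} hX x _ ↦ ?_⟩⟩
  have hX' : ∀ y, CMDiffAt ∞ (T% X) y := fun y ↦ (hX y trivial).contMDiffAt Filter.univ_mem
  refine (contMDiffAt_hom_of_apply fun Y hY ↦ ?_).contMDiffWithinAt
  refine contMDiffAt_leftFrame ?_
  have h1 : CMDiffAt ∞ (fun y ↦ d% (leftCoords X) y (Y y)) x :=
    contMDiffAt_mvfderiv_apply (m := ⊤) (n := ⊤) hY (contMDiffAt_leftCoords (hX' x)) (by simp)
  have h2 : CMDiffAt ∞ (fun y ↦ L (leftCoords Y y)) x :=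
    L.contDiff.contMDiff.contMDiffAt.comp x (contMDiffAt_leftCoords hY)
  exact h1.add (h2.clm_apply (contMDiffAt_leftCoords (hX' x)))

lemma leftFrame_modelBracket (u v : E) (x : G) :
    mlieBracket I (fun y ↦ leftFrame I y u) (fun y ↦ leftFrame I y v) x =
      leftFrame I x (modelBracket I G u v) := by
  have h := mulInvariantVector_mlieBracket (I := I) (G := G) u v
  exact (congrFun h x).symm

/-- The Lie bracket in the left trivialization. -/
lemma leftCoord_mlieBracket {X Y : Π x : G, TangentSpace I x} {x : G}
    (hX : MDiffAt (T% X) x) (hY : MDiffAt (T% Y) x) :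
    leftCoord I x (mlieBracket I X Y x) = d% (leftCoords Y) x (X x) - d% (leftCoords X) x (Y x) +
      modelBracket I G (leftCoords X x) (leftCoords Y x) := by
  have : IsManifold I 2 G := IsManifold.of_le (n := ∞)
    (WithTop.coe_le_coe.2 (le_top : (2 : ℕ∞) ≤ ⊤))
  let D := leftConnection I G 0
  have hinv : ∀ u : E, MDiffAt (T% (fun y : G ↦ leftFrame I y u)) x := fun u ↦
    (contMDiff_mulInvariant u).contMDiffAt.mdifferentiableAt (by simp)
  have hval : ∀ Z : Π x : G, TangentSpace I x, leftFrame I x (leftCoords Z x) = Z x := fun Z ↦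
    leftFrame_leftCoord x (Z x)
  have hcst : ∀ (u : E) (v : TangentSpace I x), D (fun y ↦ leftFrame I y u) x v = 0 := by
    intro u v
    have : leftCoords (fun y : G ↦ leftFrame I y u) = fun _ ↦ u := by
      ext y; exact leftCoords_leftFrame u y
    rw [leftConnection_apply, this, mvfderiv_const]
    simp
  have h1 := D.torsion_apply hX hY
  have h2 := D.torsion_apply (hinv (leftCoords X x)) (hinv (leftCoords Y x))
  simp only [hval] at h2
  rw [h1, hcst, hcst, leftFrame_modelBracket] at h2
  have h3 := congrArg (leftCoord I x) h2
  simp only [map_sub, map_zero, leftCoord_leftFrame, D, leftCoord_leftConnection] at h3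
  simp only [zero_apply, add_zero] at h3
  rw [sub_eq_iff_eq_add] at h3
  rw [h3]; abel

lemma isTorsionFree_leftConnection (L : E →L[ℝ] E →L[ℝ] E)
    (hL : ∀ u v, L u v - L v u = modelBracket I G u v) :
    IsTorsionFree (leftConnection I G L) := by
  intro X Y hX hY x
  apply leftCoord_injective x
  rw [leftCoord_mlieBracket (hX.contMDiffAt.mdifferentiableAt (by simp))
    (hY.contMDiffAt.mdifferentiableAt (by simp)), map_sub, leftCoord_leftConnection,
    leftCoord_leftConnection, ← hL]
  simp only [leftCoords]
  abel

lemma isFlatConnection_leftConnection (L : E →L[ℝ] E →L[ℝ] E)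
    (hF : ∀ u v w, L u (L v w) - L v (L u w) = L (modelBracket I G u v) w) :
    IsFlatConnection (leftConnection I G L) := by
  intro X Y Z hX hY hZ x
  apply leftCoord_injective x
  have hsm : ∀ {W : Π x : G, TangentSpace I x}, IsSmoothField W → CMDiffAt ∞ (leftCoords W) x :=
    fun h ↦ contMDiffAt_leftCoords h.contMDiffAt
  have hcov : ∀ {V W : Π x : G, TangentSpace I x}, IsSmoothField V → IsSmoothField W →
      leftCoord I x (leftConnection I G L (fun y ↦ leftConnection I G L Z y (V y)) x (W x)) =
        d% (fun y ↦ d% (leftCoords Z) y (V y)) x (W x)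
        + (L (d% (leftCoords V) x (W x)) (leftCoords Z x)
        + L (leftCoords V x) (d% (leftCoords Z) x (W x)))
        + L (leftCoords W x) (d% (leftCoords Z) x (V x) + L (leftCoords V x) (leftCoords Z x)) := by
    intro V W hV hW
    have h1 : leftCoords (fun y ↦ leftConnection I G L Z y (V y)) =
        (fun y ↦ d% (leftCoords Z) y (V y)) + fun y ↦ L (leftCoords V y) (leftCoords Z y) := by
      ext y; exact leftCoord_leftConnection L Z y (V y)
    have hdZ : CMDiffAt ∞ (fun y ↦ d% (leftCoords Z) y (V y)) x :=
      contMDiffAt_mvfderiv_apply (m := ⊤) (n := ⊤) hV.contMDiffAt (hsm hZ) (by simp)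
    have h2 : CMDiffAt ∞ (fun y ↦ L (leftCoords V y)) x :=
      L.contDiff.contMDiff.contMDiffAt.comp x (hsm hV)
    rw [leftCoord_leftConnection, h1, mvfderiv_add (hdZ.mdifferentiableAt (by simp))
      ((h2.clm_apply (hsm hZ)).mdifferentiableAt (by simp)), add_apply,
      mvfderiv_bilin_apply L ((hsm hV).mdifferentiableAt (by simp))
      ((hsm hZ).mdifferentiableAt (by simp))]
    rfl
  rw [curvature, map_sub, map_sub, hcov hY hX, hcov hX hY, leftCoord_leftConnection,
    mvfderiv_mlieBracket_apply hX.contMDiffAt hY.contMDiffAt (hsm hZ),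
    leftCoord_mlieBracket (hX.contMDiffAt.mdifferentiableAt (by simp))
    (hY.contMDiffAt.mdifferentiableAt (by simp)), map_zero]
  simp only [map_add, map_sub, add_apply, sub_apply, ← hF]
  abel

end LeftConnection

section InvariantMetric

variable {E : Type*} [NormedAddCommGroup E] [NormedSpace ℝ E] [FiniteDimensional ℝ E]
  {H : Type*} [TopologicalSpace H] {I : ModelWithCorners ℝ E H}
  {G : Type*} [TopologicalSpace G] [ChartedSpace H G] [Group G] [LieGroup I ∞ G]
  [IsManifold I 1 G]

/-- The scalar product on the Lie algebra, on the model space. -/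
def SemiRiemannianMetric.formOne (g : SemiRiemannianMetric I G) : E →L[ℝ] E →L[ℝ] ℝ :=
  g.form 1

omit [FiniteDimensional ℝ E] [Group G] [LieGroup I ∞ G] in
lemma SemiRiemannianMetric.form_congr (g : SemiRiemannianMetric I G) {x y : G} (h : x = y)
    (v w : E) : g.form x v w = g.form y v w := by
  subst h; rfl

omit [FiniteDimensional ℝ E] [LieGroup I ∞ G] in
lemma form_leftFrame {g : SemiRiemannianMetric I G} (hg : g.IsLeftInvariant) (x : G) (v w : E) :
    g.form x (leftFrame I x v) (leftFrame I x w) = g.formOne v w :=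
  (g.form_congr (mul_one x).symm _ _).trans (hg x 1 v w)

omit [FiniteDimensional ℝ E] in
lemma form_eq_formOne {g : SemiRiemannianMetric I G} (hg : g.IsLeftInvariant) (x : G)
    (v w : TangentSpace I x) :
    g.form x v w = g.formOne (leftCoord I x v) (leftCoord I x w) := by
  rw [← form_leftFrame hg, leftFrame_leftCoord, leftFrame_leftCoord]

omit [FiniteDimensional ℝ E] [LieGroup I ∞ G] in
lemma form_rightInvariantField {g : SemiRiemannianMetric I G} (hg : g.IsRightInvariant) (x : G)
    (v w : E) :
    g.form x (rightInvariantField v x) (rightInvariantField w x) = g.formOne v w :=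
  (g.form_congr (one_mul x).symm _ _).trans (hg x 1 v w)

omit [FiniteDimensional ℝ E] [LieGroup I ∞ G] [IsManifold I 1 G] in
lemma rightInvariantField_one (v : E) : rightInvariantField (I := I) v (1 : G) = v := by
  have : (fun y : G ↦ y * 1) = id := by ext; simp
  unfold rightInvariantField
  rw [this, mfderiv_id]; rfl

omit [FiniteDimensional ℝ E] in
lemma mdifferentiableAt_leftFrame (v : E) (x : G) :
    MDiffAt (T% (fun y : G ↦ leftFrame I y v)) x :=
  (contMDiff_mulInvariant v).contMDiffAt.mdifferentiableAt (by simp)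

omit [FiniteDimensional ℝ E] [IsManifold I 1 G] in
lemma leftCoords_leftFrame_eq (v : E) : leftCoords (fun y : G ↦ leftFrame I y v) = fun _ ↦ v := by
  ext y; exact leftCoords_leftFrame v y

omit [IsManifold I 1 G] in
/-- The derivative at the identity of the inverse of the adjoint representation. -/
lemma mvfderiv_leftCoords_rightInvariantField (u v : E) :
    mvfderiv I (leftCoords (I := I) (rightInvariantField v)) (1 : G) u
      = modelBracket I G v u := by
  have h := leftCoord_mlieBracket (x := (1 : G))
    ((contMDiff_rightInvariantField v).contMDiffAt.mdifferentiableAt (by simp))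
    (mdifferentiableAt_leftFrame (I := I) u 1)
  have h0 : mlieBracket I (rightInvariantField v) (fun y ↦ leftFrame I y u) (1 : G) = 0 :=
    mlieBracket_rightInvariantField_mulInvariant v u
  rw [h0, leftCoords_leftFrame_eq, mvfderiv_const, map_zero, leftFrame_one] at h
  have h1 : leftCoords (rightInvariantField (I := I) v) (1 : G) = v := by
    rw [leftCoords, leftCoord_one, rightInvariantField_one]
  rw [h1, zero_apply, zero_sub, neg_add_eq_sub] at h
  exact (sub_eq_zero.1 h.symm).symm

lemma formOne_modelBracket {g : SemiRiemannianMetric I G} (hg : g.IsBiInvariant) (u v w : E) :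
    g.formOne (modelBracket I G v u) w + g.formOne v (modelBracket I G w u) = 0 := by
  have hconst : (fun x : G ↦ g.formOne (leftCoords (I := I) (rightInvariantField v) x)
      (leftCoords (I := I) (rightInvariantField w) x)) = fun _ ↦ g.formOne v w := by
    ext x
    rw [← form_rightInvariantField hg.2 x v w, form_eq_formOne hg.1]
    rfl
  have hd : ∀ v : E,
      MDifferentiableAt I 𝓘(ℝ, E) (leftCoords (I := I) (rightInvariantField v)) (1 : G) := fun v ↦
    (contMDiffAt_leftCoords (contMDiff_rightInvariantField v).contMDiffAt).mdifferentiableAt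
      (by simp)
  have h := mvfderiv_bilin_apply g.formOne (hd v) (hd w) u
  rw [hconst, mvfderiv_const, mvfderiv_leftCoords_rightInvariantField,
    mvfderiv_leftCoords_rightInvariantField, leftCoords, leftCoords, leftCoord_one, leftCoord_one,
    rightInvariantField_one, rightInvariantField_one] at h
  exact h.symm

variable {g : SemiRiemannianMetric I G}
  {cov : CovariantDerivative I E (fun x : G ↦ TangentSpace I x)}

omit [FiniteDimensional ℝ E] in
lemma isSmoothField_leftFrame (v : E) : IsSmoothField (fun x : G ↦ leftFrame I x v) :=
  contMDiff_mulInvariant v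

/-- The Levi-Civita connection of a left invariant metric, on left invariant vector fields. -/
lemma cov_leftFrame_eq (hg : g.IsLeftInvariant) (hcov : IsLeviCivita g cov) (x : G) (u v : E) :
    cov (fun y ↦ leftFrame I y v) x (leftFrame I x u) =
      leftFrame I x (cov (fun y ↦ leftFrame I y v) 1 u) := by
  let D : G → E → E → E := fun x u v ↦
    leftCoord I x (cov (fun y ↦ leftFrame I y v) x (leftFrame I x u))
  have hT : ∀ x u v, D x u v - D x v u = modelBracket I G u v := by
    intro x u v
    have h := hcov.torsionFree _ _ (isSmoothField_leftFrame u) (isSmoothField_leftFrame v) x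
    rw [leftFrame_modelBracket] at h
    simp only [D]
    rw [← map_sub, h, leftCoord_leftFrame]
  have hM : ∀ x u v w, g.formOne (D x u v) w + g.formOne v (D x u w) = 0 := by
    intro x u v w
    have h := hcov.metric _ _ (isSmoothField_leftFrame v) (isSmoothField_leftFrame w) x
      (leftFrame I x u)
    have hc : (fun y : G ↦ g.form y (leftFrame I y v) (leftFrame I y w)) =
        fun _ ↦ g.formOne v w := by
      ext y; exact form_leftFrame hg y v w
    have e₁ := form_eq_formOne hg x (cov (fun y ↦ leftFrame I y v) x (leftFrame I x u))
      (leftFrame I x w)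
    have e₂ := form_eq_formOne hg x (leftFrame I x v)
      (cov (fun y ↦ leftFrame I y w) x (leftFrame I x u))
    rw [leftCoord_leftFrame] at e₁ e₂
    rw [hc, mfderiv_const] at h
    exact (congrArg₂ (· + ·) e₁ e₂).symm.trans h.symm
  have hS : D x u v = D 1 u v := by
    have hnd : ∀ a : E, (∀ w, g.formOne a w = 0) → a = 0 := fun a ha ↦ g.nondegenerate 1 a ha
    rw [← sub_eq_zero]
    apply hnd
    intro w
    have hs : ∀ a b, D x a b - D 1 a b = D x b a - D 1 b a := by
      intro a b
      have h1 := hT x a b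
      rw [← hT 1 a b] at h1
      rw [sub_eq_sub_iff_add_eq_add] at h1 ⊢
      rw [add_comm (D x b a), ← h1]
    have ha : ∀ a b c, g.formOne (D x a b - D 1 a b) c = - g.formOne (D x a c - D 1 a c) b := by
      intro a b c
      have h1 := hM x a b c
      have h2 := hM 1 a b c
      have hsymm : ∀ a b : E, g.formOne a b = g.formOne b a := fun a b ↦ g.symm 1 a b
      rw [hsymm b] at h1 h2
      simp only [map_sub, sub_apply]
      linarith
    have h1 := ha u v w
    rw [hs u w, ha w u v, hs w v, ha v w u, hs v u] at h1
    linarith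
  have h := congrArg (leftFrame I x) hS
  simp only [D, leftFrame_leftCoord, leftFrame_one, leftCoord_one] at h
  exact h

omit [FiniteDimensional ℝ E] in
lemma cov_leftFrame_add (x : G) (v w : E) :
    cov (fun y ↦ leftFrame I y (v + w)) x =
      cov (fun y ↦ leftFrame I y v) x + cov (fun y ↦ leftFrame I y w) x := by
  have h : (fun y : G ↦ leftFrame I y (v + w)) =
      (fun y ↦ leftFrame I y v) + fun y ↦ leftFrame I y w := by
    ext y; exact map_add _ _ _
  rw [h]
  exact cov.isCovariantDerivativeOnUniv.add (mdifferentiableAt_leftFrame v x)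
    (mdifferentiableAt_leftFrame w x)

omit [FiniteDimensional ℝ E] in
lemma cov_leftFrame_smul (x : G) (c : ℝ) (v : E) :
    cov (fun y ↦ leftFrame I y (c • v)) x = c • cov (fun y ↦ leftFrame I y v) x := by
  have h : (fun y : G ↦ leftFrame I y (c • v)) = c • (fun y ↦ leftFrame I y v) := by
    ext y; exact map_smul _ _ _
  rw [h]
  exact cov.isCovariantDerivativeOnUniv.smul_const c (mdifferentiableAt_leftFrame v x)

variable (cov) in
/-- The product on the Lie algebra given by a connection. -/
def connectionProduct : E →ₗ[ℝ] E →ₗ[ℝ] E :=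
  LinearMap.mk₂ ℝ (fun u v : E ↦ (cov (fun y ↦ leftFrame I y v) 1 u : E))
    (fun _ _ _ ↦ map_add (cov _ 1) _ _) (fun _ _ _ ↦ map_smul (cov _ 1) _ _)
    (fun u v w ↦ congrArg (fun T ↦ T u) (cov_leftFrame_add (cov := cov) 1 v w))
    (fun c u v ↦ congrArg (fun T ↦ T u) (cov_leftFrame_smul (cov := cov) 1 c v))

lemma leftFrame_connectionProduct (hg : g.IsLeftInvariant) (hcov : IsLeviCivita g cov) (x : G)
    (u v : E) : leftFrame I x (connectionProduct cov u v) =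
      cov (fun y ↦ leftFrame I y v) x (leftFrame I x u) :=
  (cov_leftFrame_eq hg hcov x u v).symm

lemma connectionProduct_sub (hcov : IsLeviCivita g cov) (u v : E) :
    connectionProduct cov u v - connectionProduct cov v u = modelBracket I G u v := by
  have h := hcov.torsionFree _ _ (isSmoothField_leftFrame u) (isSmoothField_leftFrame v) 1
  rw [leftFrame_modelBracket, leftFrame_one, leftFrame_one, leftFrame_one] at h
  exact h

omit [FiniteDimensional ℝ E] in
lemma formOne_connectionProduct (hg : g.IsLeftInvariant) (hcov : IsLeviCivita g cov) (u v w : E) :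
    g.formOne (connectionProduct cov u v) w + g.formOne v (connectionProduct cov u w) = 0 := by
  have h := hcov.metric _ _ (isSmoothField_leftFrame v) (isSmoothField_leftFrame w) 1 u
  have hc : (fun y : G ↦ g.form y (leftFrame I y v) (leftFrame I y w)) =
      fun _ ↦ g.formOne v w := by
    ext y; exact form_leftFrame hg y v w
  rw [hc, mfderiv_const, leftFrame_one, leftFrame_one] at h
  exact h.symm

lemma connectionProduct_flat (hg : g.IsLeftInvariant) (hcov : IsLeviCivita g cov)
    (hflat : IsFlatConnection cov) (u v w : E) :
    connectionProduct cov u (connectionProduct cov v w) -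
      connectionProduct cov v (connectionProduct cov u w) =
      connectionProduct cov (modelBracket I G u v) w := by
  have h := hflat _ _ _ (isSmoothField_leftFrame u) (isSmoothField_leftFrame v)
    (isSmoothField_leftFrame w) 1
  simp only [curvature, ← leftFrame_connectionProduct hg hcov, leftFrame_modelBracket] at h
  rw [leftFrame_one, leftFrame_one, leftFrame_one] at h
  exact sub_eq_zero.1 h

end InvariantMetric

end Geometry

section OscillatorAlgebra

variable {𝔤 : Type*} [LieRing 𝔤] [LieAlgebra ℝ 𝔤]

/-- The basis `b` identifies `𝔤` with the oscillator algebra (`c < 0`) or its split form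
(`c > 0`). -/
structure IsOscillatorBasis (b : Module.Basis (Fin 4) ℝ 𝔤) (c : ℝ) : Prop where
  ne_zero : c ≠ 0
  lie_zero : ∀ x : 𝔤, ⁅b 0, x⁆ = 0
  lie_one_two : ⁅b 1, b 2⁆ = b 3
  lie_one_three : ⁅b 1, b 3⁆ = c • b 2
  lie_two_three : ⁅b 2, b 3⁆ = b 0

/-- The product `P` is the Levi-Civita product of the nondegenerate symmetric bilinear form `m`,
and is flat. -/
structure IsFlatMetricProduct (m : 𝔤 →ₗ[ℝ] 𝔤 →ₗ[ℝ] ℝ) (P : 𝔤 →ₗ[ℝ] 𝔤 →ₗ[ℝ] 𝔤) : Prop where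
  symm : ∀ x y, m x y = m y x
  nondegenerate : ∀ x, (∀ y, m x y = 0) → x = 0
  skew : ∀ x y z, m (P x y) z + m y (P x z) = 0
  torsionFree : ∀ x y, P x y - P y x = ⁅x, y⁆
  flat : ∀ x y z, P x (P y z) - P y (P x z) = P ⁅x, y⁆ z

lemma Basis.forall_of_linear {b : Module.Basis (Fin 4) ℝ 𝔤} {p : 𝔤 → Prop}
    (hadd : ∀ x y, p x → p y → p (x + y)) (hsmul : ∀ (t : ℝ) x, p x → p (t • x))
    (hb : ∀ i, p (b i)) (x : 𝔤) : p x := by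
  rw [← b.sum_repr x, Fin.sum_univ_four]
  exact hadd _ _ (hadd _ _ (hadd _ _ (hsmul _ _ (hb _)) (hsmul _ _ (hb _))) (hsmul _ _ (hb _)))
    (hsmul _ _ (hb _))

namespace IsOscillatorBasis

variable {b : Module.Basis (Fin 4) ℝ 𝔤} {c : ℝ} (hb : IsOscillatorBasis b c)
include hb

lemma lie_zero_right (x : 𝔤) : ⁅x, b 0⁆ = 0 := by
  rw [← lie_skew, hb.lie_zero, neg_zero]

/-- The left symmetric product on the oscillator algebra. -/
lemma exists_leftSymmetric : ∃ P : 𝔤 →ₗ[ℝ] 𝔤 →ₗ[ℝ] 𝔤,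
    (∀ x y, P x y - P y x = ⁅x, y⁆) ∧
    ∀ x y z, P x (P y z) - P y (P x z) = P ⁅x, y⁆ z := by
  let P : 𝔤 →ₗ[ℝ] 𝔤 →ₗ[ℝ] 𝔤 := b.constr ℝ ![0,
    b.constr ℝ ![0, 0, b 3, c • b 2],
    b.constr ℝ ![0, 0, 0, (1 / 2 : ℝ) • b 0],
    b.constr ℝ ![0, 0, -(1 / 2 : ℝ) • b 0, 0]]
  have h0 : ∀ x, P (b 0) x = 0 := by intro x; simp [P]
  have hx0 : ∀ x, P x (b 0) = 0 := by
    refine Basis.forall_of_linear (b := b) (fun x y hx hy ↦ by simp [hx, hy])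
      (fun t x hx ↦ by simp [hx]) fun i ↦ ?_
    fin_cases i <;> simp [P]
  have hx1 : ∀ x, P x (b 1) = 0 := by
    refine Basis.forall_of_linear (b := b) (fun x y hx hy ↦ by simp [hx, hy])
      (fun t x hx ↦ by simp [hx]) fun i ↦ ?_
    fin_cases i <;> simp [P]
  have h12 : P (b 1) (b 2) = b 3 := by simp [P]
  have h13 : P (b 1) (b 3) = c • b 2 := by simp [P]
  have h22 : P (b 2) (b 2) = 0 := by simp [P]
  have h23 : P (b 2) (b 3) = (1 / 2 : ℝ) • b 0 := by simp [P]
  have h32 : P (b 3) (b 2) = -(1 / 2 : ℝ) • b 0 := by simp [P]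
  have h33 : P (b 3) (b 3) = 0 := by simp [P]
  have l21 : ⁅b 2, b 1⁆ = -b 3 := by rw [← lie_skew, hb.lie_one_two]
  have l31 : ⁅b 3, b 1⁆ = -(c • b 2) := by rw [← lie_skew, hb.lie_one_three]
  have l32 : ⁅b 3, b 2⁆ = -b 0 := by rw [← lie_skew, hb.lie_two_three]
  refine ⟨P, ?_, ?_⟩
  · intro x
    refine Basis.forall_of_linear (b := b) (fun y z hy hz ↦ ?_) (fun t y hy ↦ ?_) fun i ↦ ?_
    · simp only [map_add, LinearMap.add_apply, lie_add, ← hy, ← hz]; abel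
    · simp only [map_smul, LinearMap.smul_apply, lie_smul, ← hy]; module
    revert x
    refine Basis.forall_of_linear (b := b) (fun y z hy hz ↦ ?_) (fun t y hy ↦ ?_) fun j ↦ ?_
    · simp only [map_add, LinearMap.add_apply, add_lie, ← hy, ← hz]; abel
    · simp only [map_smul, LinearMap.smul_apply, smul_lie, ← hy]; module
    fin_cases i <;> fin_cases j <;>
      simp [h0, hx0, hx1, h12, h13, h22, h23, h32, h33, hb.lie_zero, hb.lie_zero_right,
        hb.lie_one_two, hb.lie_one_three, hb.lie_two_three, l21, l31, l32] <;> module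
  · intro x y z
    revert x
    refine Basis.forall_of_linear (b := b) (fun u v hu hv ↦ ?_) (fun t u hu ↦ ?_) fun i ↦ ?_
    · simp only [map_add, LinearMap.add_apply, add_lie, ← hu, ← hv]; abel
    · simp only [map_smul, LinearMap.smul_apply, smul_lie, ← hu]; module
    revert y
    refine Basis.forall_of_linear (b := b) (fun u v hu hv ↦ ?_) (fun t u hu ↦ ?_) fun j ↦ ?_
    · simp only [map_add, LinearMap.add_apply, lie_add, ← hu, ← hv]; abel
    · simp only [map_smul, LinearMap.smul_apply, lie_smul, ← hu]; module
    revert z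
    refine Basis.forall_of_linear (b := b) (fun u v hu hv ↦ ?_) (fun t u hu ↦ ?_) fun k ↦ ?_
    · simp only [map_add, ← hu, ← hv]; abel
    · simp only [map_smul, ← hu]; module
    fin_cases i <;> fin_cases j <;> fin_cases k <;>
      simp [h0, hx0, hx1, h12, h13, h22, h23, h32, h33, hb.lie_zero, hb.lie_zero_right,
        hb.lie_one_two, hb.lie_one_three, hb.lie_two_three, l21, l31, l32]

end IsOscillatorBasis

end OscillatorAlgebra

section FlatMetric

variable {𝔤 : Type*} [LieRing 𝔤] [LieAlgebra ℝ 𝔤]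
  {b : Module.Basis (Fin 4) ℝ 𝔤} {c : ℝ}
  {m : 𝔤 →ₗ[ℝ] 𝔤 →ₗ[ℝ] ℝ} {P : 𝔤 →ₗ[ℝ] 𝔤 →ₗ[ℝ] 𝔤}

namespace IsFlatMetricProduct

lemma skew_self (hP : IsFlatMetricProduct m P) (x y : 𝔤) : m (P x y) y = 0 := by
  have h := hP.skew x y y
  rw [hP.symm y] at h
  linarith

lemma eq_zero_of_basis (hP : IsFlatMetricProduct m P) {x : 𝔤} (h : ∀ i, m x (b i) = 0) : x = 0 :=
  hP.nondegenerate x (Basis.forall_of_linear (b := b) (fun y z hy hz ↦ by simp [hy, hz])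
    (fun t y hy ↦ by simp [hy]) h)

variable (hP : IsFlatMetricProduct m P) {v : 𝔤} (hv : ∀ x : 𝔤, ⁅v, x⁆ = 0)
include hP hv

lemma central_comm (x : 𝔤) : P x v = P v x := by
  rw [← sub_eq_zero, ← neg_sub, hP.torsionFree, hv, neg_zero]

lemma central_commute (x y : 𝔤) : P x (P v y) = P v (P x y) := by
  have h := hP.flat v x y
  rw [hv, map_zero, LinearMap.zero_apply, sub_eq_zero] at h
  exact h.symm

lemma two_mul_central (x y : 𝔤) : 2 * m (P v x) y = - m v ⁅x, y⁆ := by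
  have h1 := hP.skew x v y
  have h2 := hP.skew y v x
  have h3 := hP.skew v x y
  rw [central_comm hP hv] at h1 h2
  rw [← hP.torsionFree, map_sub, hP.symm (P v y) x] at *
  linarith

lemma central_self : P v v = 0 := by
  refine hP.nondegenerate _ fun y ↦ ?_
  have h := two_mul_central hP hv v y
  rw [hv, map_zero, neg_zero] at h
  linarith

lemma central_sq (x : 𝔤) : P v (P v x) = 0 := by
  rw [← central_comm hP hv x, ← central_commute hP hv, central_self hP hv, map_zero]

lemma apply_central (x : 𝔤) : m v (P v x) = 0 := by
  have h := hP.skew v v x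
  rw [central_self hP hv, map_zero, LinearMap.zero_apply, zero_add] at h
  exact h

lemma central_central (x y : 𝔤) : m (P v x) (P v y) = 0 := by
  have h := hP.skew v x (P v y)
  rw [central_sq hP hv, map_zero, add_zero] at h
  exact h

lemma lie_central (x y : 𝔤) : m v ⁅x, P v y⁆ = 0 := by
  have h := two_mul_central hP hv x (P v y)
  rw [central_central hP hv] at h
  linarith

end IsFlatMetricProduct

open IsFlatMetricProduct

variable (hb : IsOscillatorBasis b c)
include hb

lemma lie_basis_eq (y : 𝔤) :
    ⁅b 1, y⁆ = b.repr y 2 • b 3 + (b.repr y 3 * c) • b 2 ∧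
    ⁅b 2, y⁆ = -b.repr y 1 • b 3 + b.repr y 3 • b 0 ∧
    ⁅b 3, y⁆ = -(b.repr y 1 * c) • b 2 - b.repr y 2 • b 0 := by
  have l21 : ⁅b 2, b 1⁆ = -b 3 := by rw [← lie_skew, hb.lie_one_two]
  have l31 : ⁅b 3, b 1⁆ = -(c • b 2) := by rw [← lie_skew, hb.lie_one_three]
  have l32 : ⁅b 3, b 2⁆ = -b 0 := by rw [← lie_skew, hb.lie_two_three]
  have h : ∀ x : 𝔤, ⁅x, y⁆ = b.repr y 0 • ⁅x, b 0⁆ + b.repr y 1 • ⁅x, b 1⁆ + b.repr y 2 • ⁅x, b 2⁆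
      + b.repr y 3 • ⁅x, b 3⁆ := by
    intro x
    conv_lhs => rw [← b.sum_repr y, Fin.sum_univ_four]
    simp
  refine ⟨?_, ?_, ?_⟩ <;>
  · rw [h]
    simp only [hb.lie_zero_right, hb.lie_one_two, hb.lie_one_three, hb.lie_two_three, l21, l31, l32,
      lie_self]
    module

variable (hP : IsFlatMetricProduct m P)
include hP

lemma repr_central_relations (y : 𝔤) :
    b.repr (P (b 0) y) 2 * m (b 0) (b 3) + b.repr (P (b 0) y) 3 * c * m (b 0) (b 2) = 0 ∧
    -b.repr (P (b 0) y) 1 * m (b 0) (b 3) + b.repr (P (b 0) y) 3 * m (b 0) (b 0) = 0 ∧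
    -(b.repr (P (b 0) y) 1 * c) * m (b 0) (b 2) - b.repr (P (b 0) y) 2 * m (b 0) (b 0) = 0 := by
  obtain ⟨h1, h2, h3⟩ := lie_basis_eq hb (P (b 0) y)
  have k1 := lie_central hP hb.lie_zero (b 1) y
  have k2 := lie_central hP hb.lie_zero (b 2) y
  have k3 := lie_central hP hb.lie_zero (b 3) y
  rw [h1] at k1
  rw [h2] at k2
  rw [h3] at k3
  simp only [map_add, map_sub, map_smul, neg_smul, map_neg, smul_eq_mul] at k1 k2 k3
  exact ⟨by linarith, by linarith, by linarith⟩

lemma central_pairings :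
    2 * m (P (b 0) (b 1)) (b 2) = - m (b 0) (b 3) ∧
    2 * m (P (b 0) (b 1)) (b 3) = - (c * m (b 0) (b 2)) ∧
    2 * m (P (b 0) (b 2)) (b 3) = - m (b 0) (b 0) := by
  refine ⟨?_, ?_, ?_⟩
  · rw [two_mul_central hP hb.lie_zero, hb.lie_one_two]
  · rw [two_mul_central hP hb.lie_zero, hb.lie_one_three]; simp
  · rw [two_mul_central hP hb.lie_zero, hb.lie_two_three]

lemma central_null : m (b 0) (b 0) = 0 := by
  by_contra hr
  have key : ∀ y, b.repr (P (b 0) y) 1 = 0 → P (b 0) y = 0 := by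
    intro y hy
    obtain ⟨-, h2, h3⟩ := repr_central_relations hb hP y
    rw [hy] at h2 h3
    have e3 : b.repr (P (b 0) y) 3 = 0 := by
      have : b.repr (P (b 0) y) 3 * m (b 0) (b 0) = 0 := by linarith
      exact (mul_eq_zero.1 this).resolve_right hr
    have e2 : b.repr (P (b 0) y) 2 = 0 := by
      have : b.repr (P (b 0) y) 2 * m (b 0) (b 0) = 0 := by linarith
      exact (mul_eq_zero.1 this).resolve_right hr
    have hsum := b.sum_repr (P (b 0) y)
    rw [Fin.sum_univ_four, hy, e2, e3] at hsum
    have h4 := apply_central hP hb.lie_zero y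
    rw [← hsum] at h4 ⊢
    simp only [zero_smul, add_zero, map_smul, smul_eq_mul] at h4 ⊢
    rw [(mul_eq_zero.1 h4).resolve_right hr, zero_smul]
  obtain ⟨-, -, h23⟩ := central_pairings hb hP
  have h32 := hP.skew (b 0) (b 2) (b 3)
  rw [hP.symm (b 2)] at h32
  set β₂ := b.repr (P (b 0) (b 2)) 1
  set β₃ := b.repr (P (b 0) (b 3)) 1
  have hz : P (b 0) (β₃ • b 2 - β₂ • b 3) = 0 := by
    apply key
    simp [β₂, β₃]
    ring
  have hβ₂ : β₂ = 0 := by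
    have h := congrArg (fun t ↦ m t (b 2)) hz
    simp only [map_sub, map_smul, LinearMap.sub_apply, LinearMap.smul_apply, skew_self hP,
      smul_eq_mul, map_zero, LinearMap.zero_apply] at h
    have : β₂ * m (b 0) (b 0) = 0 := by linear_combination -2 * h - 2 * β₂ * h32 + β₂ * h23
    exact (mul_eq_zero.1 this).resolve_right hr
  rw [key (b 2) hβ₂] at h23
  simp at h23
  exact hr h23

lemma exists_central_eq (h : m (b 0) (b 2) ≠ 0 ∨ m (b 0) (b 3) ≠ 0) :
    ∃ (y : 𝔤) (α β : ℝ), β ≠ 0 ∧ P (b 0) y =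
      α • b 0 + β • ((c * m (b 0) (b 2)) • b 2 - m (b 0) (b 3) • b 3) := by
  have hc := hb.ne_zero
  have hD : (c * m (b 0) (b 2)) ^ 2 + m (b 0) (b 3) ^ 2 ≠ 0 := by
    rcases h with h | h
    · have := mul_ne_zero hc h; positivity
    · positivity
  by_contra! hne
  have hr := central_null hb hP
  have key : ∀ y, P (b 0) y = b.repr (P (b 0) y) 0 • b 0 := by
    intro y
    obtain ⟨h1, h2, h3⟩ := repr_central_relations hb hP y
    have hsum := b.sum_repr (P (b 0) y)
    rw [Fin.sum_univ_four] at hsum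
    set p := m (b 0) (b 2)
    set q := m (b 0) (b 3)
    set n := b.repr (P (b 0) y)
    rw [hr] at h2 h3
    have hn1 : n 1 = 0 := by
      rcases h with h | h
      · have : n 1 * (c * p) = 0 := by linarith
        exact (mul_eq_zero.1 this).resolve_right (mul_ne_zero hc h)
      · have : n 1 * q = 0 := by linarith
        exact (mul_eq_zero.1 this).resolve_right h
    set β := (n 2 * (c * p) - n 3 * q) / ((c * p) ^ 2 + q ^ 2)
    have e2 : n 2 = β * (c * p) := by
      simp only [β]; rw [div_mul_eq_mul_div, eq_div_iff hD]; linear_combination q * h1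
    have e3 : n 3 = - (β * q) := by
      simp only [β]; rw [div_mul_eq_mul_div, ← neg_div, eq_div_iff hD]; linear_combination (c * p) * h1
    have hN : P (b 0) y = n 0 • b 0 + β • ((c * p) • b 2 - q • b 3) := by
      rw [← hsum, hn1, e2, e3]; module
    by_cases hβ : β = 0
    · rw [hN, hβ]; simp
    · exact absurd hN (hne y _ _ hβ)
  obtain ⟨h12, h13, -⟩ := central_pairings hb hP
  have h11 := skew_self hP (b 0) (b 1)
  have h21 := hP.skew (b 0) (b 1) (b 2)
  have h31 := hP.skew (b 0) (b 1) (b 3)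
  rw [hP.symm (b 1)] at h21 h31
  rw [key (b 1)] at h11
  have k : ∀ z, m (P (b 0) z) (b 1) = b.repr (P (b 0) z) 0 * m (b 0) (b 1) := by
    intro z
    conv_lhs => rw [key z]
    rw [map_smul, LinearMap.smul_apply, smul_eq_mul]
  have k2 := k (b 2)
  have k3 := k (b 3)
  simp only [map_smul, LinearMap.smul_apply, smul_eq_mul] at h11
  have : m (P (b 0) (b 1)) (b 2) = 0 ∧ m (P (b 0) (b 1)) (b 3) = 0 := by
    rcases mul_eq_zero.1 h11 with h0 | h0
    · rw [key (b 1), h0]; simp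
    · rw [h0, mul_zero] at k2 k3
      exact ⟨by linarith, by linarith⟩
  rw [this.1] at h12
  rw [this.2] at h13
  have hcp : c * m (b 0) (b 2) = 0 := by linarith
  rcases h with h | h
  · exact h ((mul_eq_zero.1 hcp).resolve_left hc)
  · exact h (by linarith)

lemma central_orthogonal : m (b 0) (b 2) = 0 ∧ m (b 0) (b 3) = 0 := by
  by_contra hne
  have hc := hb.ne_zero
  obtain ⟨y, α, β, hβ, hy⟩ := exists_central_eq hb hP (by tauto)
  have hr := central_null hb hP
  obtain ⟨h12, h13, h23⟩ := central_pairings hb hP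
  set p := m (b 0) (b 2) with hp
  set q := m (b 0) (b 3) with hq
  obtain ⟨e, he⟩ : ∃ e, e = (c * p) • b 2 - q • b 3 := ⟨_, rfl⟩
  rw [← he] at hy
  have hey : β • e = P (b 0) y - α • b 0 := by rw [hy]; module
  have hye : m (P (b 0) y) (b 0) = 0 := by rw [hP.symm, apply_central hP hb.lie_zero]
  have ortho : ∀ {z : 𝔤}, m (β • e) z = 0 → m e z = 0 := by
    intro z h
    rw [map_smul, LinearMap.smul_apply, smul_eq_mul] at h
    exact (mul_eq_zero.1 h).resolve_left hβ
  have hev : m e (b 0) = 0 := by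
    apply ortho
    rw [hey]; simp [hye, hr]
  have hee : m e e = 0 := by
    apply ortho
    have : β • m (β • e) e = 0 := by
      rw [← map_smul, hey]
      simp [hye, hr, central_central hP hb.lie_zero, apply_central hP hb.lie_zero]
    exact (mul_eq_zero.1 this).resolve_left hβ
  have hpq : c * p ^ 2 = q ^ 2 := by
    have h := hev
    rw [hP.symm, he] at h
    simp only [map_sub, map_smul, smul_eq_mul, ← hp, ← hq] at h
    linarith
  have hp0 : p ≠ 0 := by
    intro h
    rw [h] at hpq
    exact hne ⟨h, by nlinarith⟩
  have hq0 : q ≠ 0 := by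
    intro h
    rw [h] at hpq
    have : c * p ^ 2 = 0 := by linarith
    rcases mul_eq_zero.1 this with h' | h'
    · exact hc h'
    · exact hp0 (pow_eq_zero_iff (two_ne_zero) |>.1 h')
  have l1 : p • ⁅b 1, e⁆ = -q • e := by
    simp only [he, lie_sub, lie_smul, hb.lie_one_two, hb.lie_one_three]
    match_scalars <;> first | linear_combination (exp := 1) -hpq | linear_combination hpq | ring1
  have l2 : ⁅b 2, e⁆ = -q • b 0 := by
    simp [he, lie_sub, lie_smul, hb.lie_two_three]
  have l3 : ⁅b 3, e⁆ = -(c * p) • b 0 := by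
    rw [he, lie_sub, lie_smul, lie_smul, lie_self, ← lie_skew, hb.lie_two_three]
    module
  have lv : ∀ x : 𝔤, m ⁅x, e⁆ (b 0) = 0 ∧ m ⁅x, e⁆ e = 0 := by
    refine Basis.forall_of_linear (b := b) (fun x z hx hz ↦ by simp [hx, hz])
      (fun t x hx ↦ by simp [hx]) fun i ↦ ?_
    fin_cases i
    · simp [hb.lie_zero]
    · have k : ∀ z, m e z = 0 → m ⁅b 1, e⁆ z = 0 := by
        intro z hz
        have := congrArg (fun t ↦ m t z) l1
        simp only [map_smul, LinearMap.smul_apply, smul_eq_mul, hz, mul_zero] at this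
        exact (mul_eq_zero.1 this).resolve_left hp0
      exact ⟨k _ hev, k _ hee⟩
    · simp [l2, hr, hP.symm (b 0) e, hev]
    · simp [l3, hr, hP.symm (b 0) e, hev]
  have hNe : P (b 0) e = 0 := by
    refine (smul_eq_zero.1 (?_ : β • P (b 0) e = 0)).resolve_left hβ
    rw [← map_smul, hey]
    simp [central_sq hP hb.lie_zero, central_self hP hb.lie_zero]
  have hxe : ∀ x, ∃ z, P x e = P (b 0) z := by
    intro x
    refine ⟨β⁻¹ • (P x y - α • x), ?_⟩
    rw [map_smul, map_sub, map_smul, ← central_commute hP hb.lie_zero,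
      ← central_comm hP hb.lie_zero x, ← map_smul, ← map_sub, ← hey, ← map_smul, smul_smul,
      inv_mul_cancel₀ hβ, one_smul]
  have hxv : ∀ x, m (P x e) (b 0) = 0 ∧ m (P x e) e = 0 := by
    intro x
    obtain ⟨z, hz⟩ := hxe x
    have := hP.skew (b 0) z e
    rw [hNe, map_zero (m z), add_zero] at this
    rw [hz, this, hP.symm, apply_central hP hb.lie_zero]
    simp
  have hex : ∀ x, P e x = P x e - ⁅x, e⁆ := by
    intro x; rw [← hP.torsionFree]; abel
  have hexv : ∀ x, m (P e x) (b 0) = 0 ∧ m (P e x) e = 0 := by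
    intro x; rw [hex]; simp [lv, hxv]
  set ν := m (P (b 0) (b 1)) (b 2) with hν
  have hν0 : ν ≠ 0 := by
    intro h; rw [h] at h12; exact hq0 (by linarith)
  set μ := m (P e (b 1)) (b 2) / ν with hμ
  let D := P e - μ • P (b 0)
  have Dskew : ∀ x z, m (D x) z + m x (D z) = 0 := by
    intro x z
    have h1 := hP.skew e x z
    have h2 := hP.skew (b 0) x z
    simp only [D, LinearMap.sub_apply, LinearMap.smul_apply, map_sub, map_smul, smul_eq_mul]
    linear_combination h1 - μ * h2
  have Dself : ∀ x, m (D x) x = 0 := by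
    intro x
    have h := Dskew x x
    rw [hP.symm x] at h
    linarith
  have Dnull : ∀ x z, D z = 0 → m (D x) z = 0 := by
    intro x z hz
    have h := Dskew x z
    rwa [hz, map_zero, add_zero] at h
  have Dv : D (b 0) = 0 := by
    refine hP.nondegenerate _ fun x ↦ ?_
    have h1 := hP.skew e (b 0) x
    rw [hP.symm (b 0), (hexv x).1, add_zero] at h1
    simp [D, h1, central_self hP hb.lie_zero]
  have De : D e = 0 := by
    refine hP.nondegenerate _ fun x ↦ ?_
    have h1 := hP.skew e e x
    rw [hP.symm e, (hexv x).2, add_zero] at h1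
    simp [D, h1, hNe]
  have Db3 : ∀ x, m (D x) (b 2) = 0 → m (D x) (b 3) = 0 := by
    intro x hx
    have h := Dnull x e De
    rw [he] at h
    simp only [map_sub, map_smul, hx, smul_eq_mul, mul_zero, zero_sub, neg_eq_zero] at h
    exact (mul_eq_zero.1 h).resolve_left hq0
  have Dw2 : m (D (b 1)) (b 2) = 0 := by
    simp only [D, LinearMap.sub_apply, LinearMap.smul_apply, map_sub, map_smul, smul_eq_mul, ← hν,
      hμ]
    field_simp
    ring
  have Dw : D (b 1) = 0 := by
    refine eq_zero_of_basis (b := b) hP fun i ↦ ?_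
    fin_cases i
    exacts [Dnull _ _ Dv, Dself _, Dw2, Db3 _ Dw2]
  have D2 : D (b 2) = 0 := by
    refine eq_zero_of_basis (b := b) hP fun i ↦ ?_
    fin_cases i
    exacts [Dnull _ _ Dv, Dnull _ _ Dw, Dself _, Db3 _ (Dself _)]
  have D3 : D (b 3) = 0 := by
    have h := De
    rw [he, map_sub, map_smul, map_smul, D2, smul_zero, zero_sub, neg_eq_zero] at h
    exact (smul_eq_zero.1 h).resolve_left hq0
  have hD : D = 0 := b.ext fun i ↦ by fin_cases i <;> simp [Dv, Dw, D2, D3]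
  have hPe : P e = μ • P (b 0) := sub_eq_zero.1 hD
  have hflat := hP.flat (b 2) e (b 1)
  rw [hPe, l2, LinearMap.smul_apply, LinearMap.smul_apply, map_smul,
    central_commute hP hb.lie_zero, sub_self, map_smul, LinearMap.smul_apply] at hflat
  have hN := (smul_eq_zero.1 hflat.symm).resolve_left (neg_ne_zero.2 hq0)
  exact hν0 (by rw [hν, hN]; simp)

omit hb in
lemma koszul (x y z : 𝔤) : 2 * m (P x y) z = m ⁅x, y⁆ z - m ⁅y, z⁆ x + m ⁅z, x⁆ y := by
  have h1 := hP.skew x y z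
  have h2 := hP.skew y x z
  have h3 := hP.skew z x y
  simp only [← hP.torsionFree, map_sub, LinearMap.sub_apply]
  rw [hP.symm y] at h1
  rw [hP.symm x] at h2 h3
  linarith

/-- Under a flat metric product the oscillator algebra and its split form are contradictory. -/
theorem not_isFlatMetricProduct : False := by
  have hc := hb.ne_zero
  have hr := central_null hb hP
  obtain ⟨hp, hq⟩ := central_orthogonal hb hP
  have hN : P (b 0) = 0 := by
    have l21 : ⁅b 2, b 1⁆ = -b 3 := by rw [← lie_skew, hb.lie_one_two]
    have l31 : ⁅b 3, b 1⁆ = -(c • b 2) := by rw [← lie_skew, hb.lie_one_three]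
    have l32 : ⁅b 3, b 2⁆ = -b 0 := by rw [← lie_skew, hb.lie_two_three]
    refine b.ext fun i ↦ eq_zero_of_basis (b := b) hP fun j ↦ ?_
    have h := two_mul_central hP hb.lie_zero (b i) (b j)
    have h' : m (b 0) ⁅b i, b j⁆ = 0 := by
      fin_cases i <;> fin_cases j <;>
        simp [hb.lie_zero, hb.lie_zero_right, hb.lie_one_two, hb.lie_one_three, hb.lie_two_three,
          l21, l31, l32, hp, hq, hr]
    rw [h'] at h
    linarith
  obtain ⟨s, hs⟩ : ∃ s, m (b 0) (b 1) = s := ⟨_, rfl⟩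
  have hs0 : s ≠ 0 := by
    rintro rfl
    refine b.ne_zero 0 (eq_zero_of_basis (b := b) hP fun i ↦ ?_)
    fin_cases i <;> assumption
  have line : ∀ z, m z (b 0) = 0 → m z (b 2) = 0 → m z (b 3) = 0 →
      z = (m z (b 1) / s) • b 0 := by
    intro z h0 h2 h3
    refine sub_eq_zero.1 (eq_zero_of_basis (b := b) hP fun i ↦ ?_)
    fin_cases i <;> simp [h0, h2, h3, hr, hp, hq, hs, hs0]
  have left : ∀ x, P (b 0) x = 0 := by simp [hN]
  have right : ∀ x, P x (b 0) = 0 := by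
    intro x; rw [central_comm hP hb.lie_zero, left]
  have pv : ∀ x y, m (P x y) (b 0) = 0 := by
    intro x y
    have h := hP.skew x y (b 0)
    rwa [right, map_zero (m y), add_zero] at h
  have expand : ∀ x y, ∃ a d e : ℝ, P x y = a • b 0 + d • b 2 + e • b 3 := by
    intro x y
    have hsum := b.sum_repr (P x y)
    rw [Fin.sum_univ_four] at hsum
    have h := pv x y
    rw [hP.symm, ← hsum] at h
    simp only [map_add, map_smul, hr, hp, hq, hs, smul_eq_mul, mul_zero, add_zero, zero_add] at h
    rw [(mul_eq_zero.1 h).resolve_right hs0, zero_smul, add_zero] at hsum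
    exact ⟨_, _, _, hsum.symm⟩
  have l32 : ⁅b 3, b 2⁆ = -b 0 := by rw [← lie_skew, hb.lie_two_three]
  have plane : ∀ {i j : Fin 4}, (i = 2 ∨ i = 3) → (j = 2 ∨ j = 3) →
      ∃ t : ℝ, P (b i) (b j) = t • b 0 := by
    intro i j hi hj
    refine ⟨_, line _ (pv _ _) ?_ ?_⟩ <;>
    · have h := koszul hP (b i) (b j) (b 2)
      have h' := koszul hP (b i) (b j) (b 3)
      rcases hi with rfl | rfl <;> rcases hj with rfl | rfl <;>
      · simp only [hb.lie_two_three, l32, lie_self, map_neg, map_zero, LinearMap.neg_apply,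
          LinearMap.zero_apply, hp, hq] at h h'
        linarith
  obtain ⟨t22, h22⟩ := plane (.inl rfl) (.inl rfl)
  obtain ⟨t23, h23⟩ := plane (.inl rfl) (.inr rfl)
  obtain ⟨t32, h32⟩ := plane (.inr rfl) (.inl rfl)
  obtain ⟨t33, h33⟩ := plane (.inr rfl) (.inr rfl)
  obtain ⟨g0, g2, g3, h11⟩ := expand (b 1) (b 1)
  obtain ⟨a0, a2, a3, h12⟩ := expand (b 1) (b 2)
  obtain ⟨d0, d2, d3, h13⟩ := expand (b 1) (b 3)
  have h21 : P (b 2) (b 1) = P (b 1) (b 2) - b 3 := by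
    rw [← hb.lie_one_two, ← hP.torsionFree]; abel
  have h31 : P (b 3) (b 1) = P (b 1) (b 3) - c • b 2 := by
    rw [← hb.lie_one_three, ← hP.torsionFree]; abel
  have f2 := hP.flat (b 1) (b 2) (b 1)
  have f3 := hP.flat (b 1) (b 3) (b 1)
  rw [hb.lie_one_two] at f2
  rw [hb.lie_one_three] at f3
  simp only [h21, h31, h11, h12, h13, h22, h23, h32, h33, map_add, map_sub, map_smul, right,
    LinearMap.smul_apply] at f2 f3
  have f22 := congrArg (fun z ↦ b.repr z 2) f2
  have f23 := congrArg (fun z ↦ b.repr z 3) f2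
  have f32 := congrArg (fun z ↦ b.repr z 2) f3
  have f33 := congrArg (fun z ↦ b.repr z 3) f3
  simp at f22 f23 f32 f33
  have g1 := skew_self hP (b 1) (b 2)
  have g4 := skew_self hP (b 1) (b 3)
  have g5 := hP.skew (b 1) (b 2) (b 3)
  rw [hP.symm (b 2)] at g5
  have hm : m (b 3) (b 2) = m (b 2) (b 3) := hP.symm _ _
  simp only [h12, h13, map_add, map_smul, LinearMap.add_apply, LinearMap.smul_apply, hp, hq, hm,
    smul_eq_mul, mul_zero, zero_add] at g1 g4 g5
  have hv2 : m (b 2) (b 0) = 0 := by rw [hP.symm, hp]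
  have hv3 : m (b 3) (b 0) = 0 := by rw [hP.symm, hq]
  have hdet : m (b 2) (b 2) * m (b 3) (b 3) - m (b 2) (b 3) ^ 2 ≠ 0 := by
    intro hdet
    have z1 := line (m (b 3) (b 3) • b 2 - m (b 2) (b 3) • b 3) (by simp [hv2, hv3])
      (by simp [hm]; linarith) (by simp; ring)
    have z2 := line (m (b 2) (b 3) • b 2 - m (b 2) (b 2) • b 3) (by simp [hv2, hv3])
      (by simp [hm]; ring) (by simp; linarith)
    have k1 := congrArg (fun z ↦ b.repr z 3) z1
    have k2 := congrArg (fun z ↦ b.repr z 3) z2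
    simp at k1 k2
    have k3 := congrArg (fun z ↦ b.repr z 2) (line (b 2) hv2 k2 k1)
    simp at k3
  have htr : a2 + d3 = 0 := by
    refine (mul_eq_zero.1 ?_).resolve_right hdet
    linear_combination m (b 3) (b 3) * g1 + m (b 2) (b 2) * g4 - m (b 2) (b 3) * g5
  obtain rfl : d3 = -a2 := by linarith
  obtain rfl : a2 = 0 := by linarith
  obtain rfl : d2 = c * a3 := by linarith
  have ha3 : a3 = 1 := by
    have : c * (a3 - 1) ^ 2 = 0 := by linarith
    have := (mul_eq_zero.1 this).resolve_left hc
    linarith [pow_eq_zero_iff (two_ne_zero) |>.1 this]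
  subst ha3
  have u1 := hP.skew (b 2) (b 1) (b 3)
  have u2 := hP.skew (b 3) (b 1) (b 2)
  have u3 := congrArg (m (b 1)) (hP.torsionFree (b 2) (b 3))
  rw [hb.lie_two_three, hP.symm (b 1) (b 0), hs, map_sub] at u3
  simp only [h21, h31, h12, h13, map_add, map_sub, map_smul, LinearMap.add_apply,
    LinearMap.sub_apply, LinearMap.smul_apply, hp, hq, smul_eq_mul] at u1 u2
  apply hs0
  linarith

end FlatMetric

section Classification

variable {𝔤 : Type*} [LieRing 𝔤] [LieAlgebra ℝ 𝔤]

/-- `B` is an invariant scalar product on `𝔤`. -/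
structure IsInvariantForm (B : 𝔤 →ₗ[ℝ] 𝔤 →ₗ[ℝ] ℝ) : Prop where
  symm : ∀ x y, B x y = B y x
  nondegenerate : ∀ x, (∀ y, B x y = 0) → x = 0
  lie_left : ∀ x y z : 𝔤, B ⁅x, y⁆ z + B y ⁅x, z⁆ = 0

namespace IsInvariantForm

variable {B : 𝔤 →ₗ[ℝ] 𝔤 →ₗ[ℝ] ℝ} (hB : IsInvariantForm B)
include hB

lemma eq_of_basis {b : Module.Basis (Fin 4) ℝ 𝔤} {x y : 𝔤} (h : ∀ i, B x (b i) = B y (b i)) :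
    x = y := by
  refine sub_eq_zero.1 (hB.nondegenerate _ (Basis.forall_of_linear (b := b)
    (fun u v hu hv ↦ by rw [map_add, hu, hv, add_zero])
    (fun t u hu ↦ by rw [map_smul, hu, smul_zero]) fun i ↦ ?_))
  simp [h]

lemma cyclic (x y z : 𝔤) : B ⁅y, z⁆ x = B ⁅x, y⁆ z := by
  have h := hB.lie_left y z x
  rw [hB.symm z] at h
  rw [← lie_skew x y, map_neg, LinearMap.neg_apply]
  linarith

omit hB in
lemma lie_swap (x y z : 𝔤) : B ⁅y, x⁆ z = -B ⁅x, y⁆ z := by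
  rw [← lie_skew, map_neg, LinearMap.neg_apply]

lemma lie_apply_right (x y : 𝔤) : B ⁅x, y⁆ y = 0 := by
  rw [← hB.cyclic, lie_self, map_zero, LinearMap.zero_apply]

lemma lie_apply_left (x y : 𝔤) : B ⁅x, y⁆ x = 0 := by
  rw [lie_swap, hB.lie_apply_right, neg_zero]

lemma lie_apply_central {v : 𝔤} (hv : ∀ x : 𝔤, ⁅v, x⁆ = 0) (x y : 𝔤) : B ⁅x, y⁆ v = 0 := by
  rw [← hB.cyclic, ← hB.cyclic, hv, map_zero, LinearMap.zero_apply]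

lemma exists_nonnull {x y : 𝔤} (h : B x y ≠ 0) : ∃ z ∈ Submodule.span ℝ {x, y}, B z z ≠ 0 := by
  by_contra! hne
  have hx := hne x (Submodule.subset_span (by simp))
  have hy := hne y (Submodule.subset_span (by simp))
  have hxy := hne (x + y) (Submodule.add_mem _ (Submodule.subset_span (by simp))
    (Submodule.subset_span (by simp)))
  simp only [map_add, LinearMap.add_apply, hx, hy, hB.symm y x] at hxy
  exact h (by linarith)

/-- On a four-dimensional quadratic Lie algebra, the invariant three-form is the contraction of the
volume form with a central vector. -/
lemma exists_central (b : Module.Basis (Fin 4) ℝ 𝔤) : ∃ v : 𝔤, v ≠ 0 ∧ ∀ x : 𝔤, ⁅v, x⁆ = 0 := by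
  obtain ⟨W, hW⟩ : ∃ W : Fin 4 → Fin 4 → Fin 4 → ℝ, ∀ i j k, B ⁅b i, b j⁆ (b k) = W i j k :=
    ⟨_, fun _ _ _ ↦ rfl⟩
  have perm : ∀ i j k, W j k i = W i j k ∧ W k i j = W i j k ∧ W j i k = -W i j k ∧
      W i k j = -W i j k ∧ W k j i = -W i j k := by
    intro i j k
    simp only [← hW]
    refine ⟨hB.cyclic _ _ _, (hB.cyclic _ _ _).symm, lie_swap _ _ _, ?_, ?_⟩
    · rw [lie_swap, ← hB.cyclic]
    · rw [lie_swap, ← hB.cyclic (b i)]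
  have d1 : ∀ i k, W i i k = 0 := fun i k ↦ by rw [← hW, lie_self, map_zero, LinearMap.zero_apply]
  have d2 : ∀ i k, W i k k = 0 := fun i k ↦ by rw [← hW, hB.lie_apply_right]
  have d3 : ∀ i k, W i k i = 0 := fun i k ↦ by rw [← hW, hB.lie_apply_left]
  obtain ⟨p1, p2, p3, p4, p5⟩ := perm 0 1 2
  obtain ⟨q1, q2, q3, q4, q5⟩ := perm 0 1 3
  obtain ⟨r1, r2, r3, r4, r5⟩ := perm 0 2 3
  obtain ⟨s1, s2, s3, s4, s5⟩ := perm 1 2 3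
  let v := W 1 2 3 • b 0 - W 0 2 3 • b 1 + W 0 1 3 • b 2 - W 0 1 2 • b 3
  by_cases hv : v = 0
  · have e0 := congrArg (fun z ↦ b.repr z 0) hv
    have e1 := congrArg (fun z ↦ b.repr z 1) hv
    have e2 := congrArg (fun z ↦ b.repr z 2) hv
    have e3 := congrArg (fun z ↦ b.repr z 3) hv
    simp [v] at e0 e1 e2 e3
    refine ⟨b 0, b.ne_zero 0, Basis.forall_of_linear (b := b)
      (fun x y hx hy ↦ by rw [lie_add, hx, hy, add_zero])
      (fun t x hx ↦ by rw [lie_smul, hx, smul_zero]) fun i ↦ hB.eq_of_basis (b := b) fun j ↦ ?_⟩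
    rw [hW, map_zero, LinearMap.zero_apply]
    fin_cases i <;> fin_cases j <;> simp [d1, d2, d3, p4, q4, r4, e1, e2, e3]
  · refine ⟨v, hv, Basis.forall_of_linear (b := b)
      (fun x y hx hy ↦ by rw [lie_add, hx, hy, add_zero])
      (fun t x hx ↦ by rw [lie_smul, hx, smul_zero]) fun i ↦ hB.eq_of_basis (b := b) fun j ↦ ?_⟩
    simp only [v, sub_lie, add_lie, smul_lie, map_sub, map_add, map_smul, LinearMap.sub_apply,
      LinearMap.add_apply, LinearMap.smul_apply, hW, map_zero, LinearMap.zero_apply, smul_eq_mul]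
    fin_cases i <;> fin_cases j <;>
    · simp only [Fin.zero_eta, Fin.mk_one, Fin.reduceFinMk, d1, d2, d3, p1, p2, p3, p4, p5, q1, q2,
        q3, q4, q5, r1, r2, r3, r4, r5, s1, s2, s3, s4, s5]
      ring

omit hB in
lemma null_of_central (hdim : 1 < Module.finrank ℝ 𝔤)
    (hund : ∀ J : LieIdeal ℝ 𝔤, J ≠ ⊥ → J ≠ ⊤ → ∃ x ∈ J, x ≠ 0 ∧ ∀ y ∈ J, B x y = 0)
    {v : 𝔤} (hv : ∀ x : 𝔤, ⁅v, x⁆ = 0) : B v v = 0 := by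
  by_cases h0 : v = 0
  · simp [h0]
  let J : LieIdeal ℝ 𝔤 :=
    { Submodule.span ℝ {v} with
      lie_mem := by
        intro x y hy
        obtain ⟨t, rfl⟩ := Submodule.mem_span_singleton.1 hy
        rw [lie_smul, ← lie_skew, hv, neg_zero, smul_zero]
        exact Submodule.zero_mem _ }
  have hJ : ∀ x, x ∈ J ↔ ∃ t : ℝ, t • v = x := fun x ↦ Submodule.mem_span_singleton
  have hvJ : v ∈ J := (hJ v).2 ⟨1, one_smul _ _⟩
  obtain ⟨x, hx, hx0, hxJ⟩ := hund J
    (fun h ↦ h0 (by rw [h] at hvJ; exact (LieSubmodule.mem_bot v).1 hvJ))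
    (fun h ↦ by
      have : Module.finrank ℝ 𝔤 ≤ 1 := finrank_le_one v fun w ↦ (hJ w).1 (by rw [h]; trivial)
      omega)
  obtain ⟨t, rfl⟩ := (hJ x).1 hx
  have h := hxJ v hvJ
  rw [map_smul, LinearMap.smul_apply, smul_eq_mul] at h
  exact (mul_eq_zero.1 h).resolve_left fun ht ↦ hx0 (by rw [ht, zero_smul])

/-- A central null vector extends to a basis that is adapted to the scalar product. -/
lemma exists_adaptedBasis (hdim : Module.finrank ℝ 𝔤 = 4) {v : 𝔤} (hv0 : v ≠ 0)
    (hvv : B v v = 0) : ∃ b : Module.Basis (Fin 4) ℝ 𝔤, b 0 = v ∧ B (b 0) (b 1) = 1 ∧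
      B (b 1) (b 1) = 0 ∧ B (b 0) (b 2) = 0 ∧ B (b 0) (b 3) = 0 ∧ B (b 1) (b 2) = 0 ∧
      B (b 1) (b 3) = 0 ∧ B (b 2) (b 3) = 0 ∧ B (b 2) (b 2) ≠ 0 ∧ B (b 3) (b 3) ≠ 0 := by
  have : FiniteDimensional ℝ 𝔤 := FiniteDimensional.of_finrank_pos (by omega)
  obtain ⟨w, hvw, hww⟩ : ∃ w, B v w = 1 ∧ B w w = 0 := by
    obtain ⟨y, hy⟩ : ∃ y, B v y ≠ 0 := by
      by_contra! h
      exact hv0 (hB.nondegenerate v h)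
    obtain ⟨u, hu⟩ : ∃ u, B v u = 1 := ⟨(B v y)⁻¹ • y, by simp [hy]⟩
    refine ⟨u - (B u u / 2) • v, by simp [hu, hvv], ?_⟩
    simp [hu, hvv, hB.symm u v]
    ring
  obtain ⟨e, hve, hwe, hee⟩ : ∃ e, B v e = 0 ∧ B w e = 0 ∧ B e e ≠ 0 := by
    obtain ⟨x, hx, hx0⟩ := (Submodule.ne_bot_iff _).1
      (LinearMap.ker_ne_bot_of_finrank_lt (f := (B v).prod (B w)) (by simp [hdim]))
    obtain ⟨hvx, hwx⟩ : B v x = 0 ∧ B w x = 0 := by simpa using hx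
    obtain ⟨y, hy⟩ : ∃ y, B x y ≠ 0 := by
      by_contra! h
      exact hx0 (hB.nondegenerate x h)
    have hy' : B x (y - B w y • v - B v y • w) ≠ 0 := by
      simpa [hB.symm x v, hB.symm x w, hvx, hwx] using hy
    obtain ⟨e, he, hee⟩ := hB.exists_nonnull hy'
    obtain ⟨s, t, rfl⟩ := Submodule.mem_span_pair.1 he
    refine ⟨_, ?_, ?_, hee⟩
    · simp [hvx, hvv, hvw]
    · simp [hwx, hww, hB.symm w v, hvw]
  obtain ⟨f, hf, hf0⟩ := (Submodule.ne_bot_iff _).1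
    (LinearMap.ker_ne_bot_of_finrank_lt (f := (B v).prod ((B w).prod (B e))) (by simp [hdim]))
  obtain ⟨hvf, hwf, hef⟩ : B v f = 0 ∧ B w f = 0 ∧ B e f = 0 := by simpa using hf
  have hli : LinearIndependent ℝ ![v, w, e, f] := by
    rw [Fintype.linearIndependent_iff]
    intro g hg
    simp only [Fin.sum_univ_four, Matrix.cons_val] at hg
    have k1 := congrArg (B v) hg
    have k2 := congrArg (B w) hg
    have k3 := congrArg (B e) hg
    simp only [map_add, map_smul, map_zero, hvv, hvw, hve, hvf, hww, hwe, hwf, hef, hB.symm w v,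
      hB.symm e v, hB.symm e w, smul_eq_mul, mul_zero, mul_one, add_zero, zero_add] at k1 k2 k3
    have k3' := (mul_eq_zero.1 k3).resolve_right hee
    rw [k1, k2, k3', zero_smul, zero_smul, zero_smul, zero_add, zero_add, zero_add] at hg
    have k4 := (smul_eq_zero.1 hg).resolve_right hf0
    intro i
    fin_cases i <;> assumption
  let b := basisOfLinearIndependentOfCardEqFinrank hli (by simp [hdim])
  have b0 : b 0 = v := by simp [b]
  have b1 : b 1 = w := by simp [b]
  have b2 : b 2 = e := by simp [b]
  have b3 : b 3 = f := by simp [b]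
  refine ⟨b, b0, ?_⟩
  rw [b0, b1, b2, b3]
  refine ⟨hvw, hww, hve, hvf, hwe, hwf, hef, hee, fun hff ↦ hf0 ?_⟩
  refine hB.eq_of_basis (b := b) fun i ↦ ?_
  fin_cases i <;>
    simp [b0, b1, b2, b3, hB.symm f v, hB.symm f w, hB.symm f e, hvf, hwf, hef, hff]

/-- An undecomposable quadratic Lie algebra of dimension four is the oscillator algebra or its
split form. -/
theorem exists_isOscillatorBasis (hdim : Module.finrank ℝ 𝔤 = 4)
    (hund : ∀ J : LieIdeal ℝ 𝔤, J ≠ ⊥ → J ≠ ⊤ → ∃ x ∈ J, x ≠ 0 ∧ ∀ y ∈ J, B x y = 0) :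
    ∃ (b : Module.Basis (Fin 4) ℝ 𝔤) (c : ℝ), IsOscillatorBasis b c := by
  have : FiniteDimensional ℝ 𝔤 := FiniteDimensional.of_finrank_pos (by omega)
  obtain ⟨v, hv0, hv⟩ := hB.exists_central (Module.finBasisOfFinrankEq ℝ 𝔤 hdim)
  obtain ⟨b, rfl, h01, h11, h02, h03, h12, h13, h23, h22, h33⟩ :=
    hB.exists_adaptedBasis hdim hv0 (null_of_central (by omega) hund hv)
  have h00 := null_of_central (by omega) hund hv
  obtain ⟨c, hc⟩ : ∃ c, B ⁅b 1, b 2⁆ (b 3) = c := ⟨_, rfl⟩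
  have hc13 : B ⁅b 1, b 3⁆ (b 2) = -c := by rw [lie_swap, ← hc, hB.cyclic (b 3)]
  have hc23 : B ⁅b 2, b 3⁆ (b 1) = c := by rw [hB.cyclic, hc]
  have l12 : ⁅b 1, b 2⁆ = (c / B (b 3) (b 3)) • b 3 := by
    refine hB.eq_of_basis (b := b) fun i ↦ ?_
    fin_cases i <;> simp [hB.lie_apply_central hv, hB.lie_apply_left, hB.lie_apply_right,
      hB.symm (b 3), h03, h13, h23, hc, h33]
  have l13 : ⁅b 1, b 3⁆ = (-c / B (b 2) (b 2)) • b 2 := by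
    refine hB.eq_of_basis (b := b) fun i ↦ ?_
    fin_cases i <;> simp [hB.lie_apply_central hv, hB.lie_apply_left, hB.lie_apply_right,
      hB.symm (b 2) (b 0), hB.symm (b 2) (b 1), h02, h12, h23, hc13, h22]
  have l23 : ⁅b 2, b 3⁆ = c • b 0 := by
    refine hB.eq_of_basis (b := b) fun i ↦ ?_
    fin_cases i <;> simp [hB.lie_apply_central hv, hB.lie_apply_left, hB.lie_apply_right,
      h00, h01, h02, h03, hc23]
  have hc0 : c ≠ 0 := by
    rintro rfl
    refine h22 (null_of_central (by omega) hund (Basis.forall_of_linear (b := b)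
      (fun x y hx hy ↦ by rw [lie_add, hx, hy, add_zero])
      (fun t x hx ↦ by rw [lie_smul, hx, smul_zero]) fun i ↦ ?_))
    fin_cases i
    · simp [← lie_skew (b 2), hv]
    · simp [← lie_skew (b 2) (b 1), l12]
    · simp
    · simp [l23]
  obtain ⟨t, ht⟩ : ∃ t, c / B (b 3) (b 3) = t := ⟨_, rfl⟩
  have ht0 : t ≠ 0 := by rw [← ht]; exact div_ne_zero hc0 h33
  rw [ht] at l12
  let u : Fin 4 → ℝ := ![t * c, 1, 1, t]
  have hu : ∀ i, IsUnit (u i) := by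
    intro i
    fin_cases i <;> simp [u, ht0, hc0]
  refine ⟨b.isUnitSMul hu, t * (-c / B (b 2) (b 2)), ?_, ?_, ?_, ?_, ?_⟩
  · exact mul_ne_zero ht0 (div_ne_zero (neg_ne_zero.2 hc0) h22)
  all_goals simp only [Module.Basis.isUnitSMul_apply]
  · simp [hv]
  · simp [u, l12]
  · simp [u, l13, smul_smul]
  · simp [u, l23, smul_smul]

end IsInvariantForm

end Classification

section LieAlgebraOfGroup

variable {E : Type*} [NormedAddCommGroup E] [NormedSpace ℝ E] [FiniteDimensional ℝ E]
  [CompleteSpace E] {H : Type*} [TopologicalSpace H] {I : ModelWithCorners ℝ E H}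
  {G : Type*} [TopologicalSpace G] [ChartedSpace H G] [Group G] [LieGroup I ∞ G]
  [IsManifold I 1 G]

/-- The scalar product of a semi-Riemannian metric on the Lie algebra. -/
def SemiRiemannianMetric.lieForm (g : SemiRiemannianMetric I G) :
    GroupLieAlgebra I G →ₗ[ℝ] GroupLieAlgebra I G →ₗ[ℝ] ℝ :=
  LinearMap.mk₂ ℝ (fun u v ↦ g.form 1 u v)
    (fun u v w ↦ by rw [map_add]; rfl) (fun t u v ↦ by rw [map_smul]; rfl)
    (fun u v w ↦ map_add _ _ _) (fun t u v ↦ map_smul _ _ _)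

lemma isInvariantForm_lieForm {g : SemiRiemannianMetric I G} (hg : g.IsBiInvariant) :
    IsInvariantForm g.lieForm where
  symm := g.symm 1
  nondegenerate := g.nondegenerate 1
  lie_left x y z := by
    have h := formOne_modelBracket hg x y z
    have h' : g.lieForm ⁅y, x⁆ z + g.lieForm y ⁅z, x⁆ = 0 := h
    rw [← lie_skew x y, ← lie_skew x z, map_neg, map_neg, LinearMap.neg_apply]
    linarith

/-- The product given by a connection, on the Lie algebra of the group. -/
def lieProduct (cov : CovariantDerivative I E (fun x : G ↦ TangentSpace I x)) :
    GroupLieAlgebra I G →ₗ[ℝ] GroupLieAlgebra I G →ₗ[ℝ] GroupLieAlgebra I G :=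
  (connectionProduct cov : E →ₗ[ℝ] E →ₗ[ℝ] E)

lemma isFlatMetricProduct_lieProduct {g : SemiRiemannianMetric I G}
    {cov : CovariantDerivative I E (fun x : G ↦ TangentSpace I x)}
    (hg : g.IsLeftInvariant) (hcov : IsLeviCivita g cov) (hflat : IsFlatConnection cov) :
    IsFlatMetricProduct g.lieForm (lieProduct cov) where
  symm := g.symm 1
  nondegenerate := g.nondegenerate 1
  skew := by
    have h := formOne_connectionProduct hg hcov
    exact h
  torsionFree := by
    have h := connectionProduct_sub hcov
    exact h
  flat := by
    have h := connectionProduct_flat hg hcov hflat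
    exact h

omit [CompleteSpace E] in
/-- A left symmetric product on the Lie algebra integrates to a left invariant affine
structure. -/
lemma exists_isLeftInvariantAffineStructure
    (P : GroupLieAlgebra I G →ₗ[ℝ] GroupLieAlgebra I G →ₗ[ℝ] GroupLieAlgebra I G)
    (h1 : ∀ x y, P x y - P y x = ⁅x, y⁆)
    (h2 : ∀ x y z, P x (P y z) - P y (P x z) = P ⁅x, y⁆ z) :
    ∃ cov : CovariantDerivative I E (fun x : G ↦ TangentSpace I x),
      IsLeftInvariantAffineStructure cov := by
  let P' : E →ₗ[ℝ] E →ₗ[ℝ] E := P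
  let L : E →L[ℝ] E →L[ℝ] E := LinearMap.toContinuousLinearMap
    ((LinearMap.toContinuousLinearMap (𝕜 := ℝ) (E := E) (F' := E)).toLinearMap ∘ₗ P')
  exact ⟨leftConnection I G L, isSmoothConnection_leftConnection L,
    isLeftInvariantConnection_leftConnection L, isTorsionFree_leftConnection L h1,
    isFlatConnection_leftConnection L h2⟩

end LieAlgebraOfGroup

end QuadraticLie

end

theorem mainTheorem6 (G : Type*) [TopologicalSpace G]
    [ChartedSpace (EuclideanSpace ℝ (Fin 4)) G] [Group G]
    [LieGroup (𝓡 4) ∞ G]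
    (k : QuadraticLie.SemiRiemannianMetric (𝓡 4) G) (hk : k.IsBiInvariant)
    (hund : QuadraticLie.IsUndecomposable k) :
    (∃ cov : CovariantDerivative (𝓡 4) (EuclideanSpace ℝ (Fin 4))
        (fun x : G ↦ TangentSpace (𝓡 4) x),
      QuadraticLie.IsLeftInvariantAffineStructure cov) ∧
    ¬ ∃ g : QuadraticLie.SemiRiemannianMetric (𝓡 4) G, g.IsLeftInvariant ∧ g.IsFlat := by
  have hdim : Module.finrank ℝ (GroupLieAlgebra (𝓡 4) G) = 4 :=
    finrank_euclideanSpace_fin (𝕜 := ℝ) (n := 4)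
  obtain ⟨b, c, hb⟩ :=
    (QuadraticLie.isInvariantForm_lieForm hk).exists_isOscillatorBasis hdim hund
  obtain ⟨P, hP1, hP2⟩ := hb.exists_leftSymmetric
  refine ⟨QuadraticLie.exists_isLeftInvariantAffineStructure P hP1 hP2, ?_⟩
  rintro ⟨g, hg, cov, hcov, hflat⟩
  exact QuadraticLie.not_isFlatMetricProduct hb
    (QuadraticLie.isFlatMetricProduct_lieProduct hg hcov hflat)
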